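/- All algorithms are in the real RAM model: indices and counters are stored in natural-number registers, matrix entries in real registers, and each basic operation (addition, subtraction, comparison and indirect addressing with natural numbers; addition, subtraction, multiplication, division and exact comparison of real numbers) takes unit time. Let $G$ be a graph with vertex set $\{1,\dots,n\}$. A $G$-partial matrix is a symmetric $n\times n$ matrix $M$ with zero diagonal, some of whose off-diagonal entries may be unspecified, such that all specified entries are nonnegative reals and, for $i\neq j$, the entry $M_{ij}$ is specified if and only if $ij\in E(G)$. For $d\in\mathbb{N}$, $(M,d)$ is a yes-instance of $d$-EDMC if there are points $p_1,\dots,p_n\in\mathbb{R}^d$, not necessarily distinct, with $M_{ij}=\|p_i-p_j\|_2^2$ for every specified entry $M_{ij}$; otherwise it is a no-instance. Two instances are equivalent if both are yes-instances or both are no-instances. An edge clique cover of $G$ of size $k$ is a family $C_1,\dots,C_k$ of cliques of $G$ such that for every edge $uv$ of $G$ there is an $i$ with $u,v\in C_i$. Theorem 1.4. There is a polynomial-time algorithm (with running time at most $P(n+k)$ for a fixed polynomial $P$) that, given an instance $(M,d)$ of $d$-EDMC in which $M$ is an $n\times n$ $G$-partial matrix and the graph $G$ is given together with an edge clique cover $\mathcal{C}$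 of size $k$, either solves the problem, that is, correctly decides whether $(M,d)$ is a yes-instance, or outputs an equivalent instance $(M',d)$ such that $M'$ is a (nonempty) $n'\times n'$ principal submatrix of $M$, where $n'\le (d+1)k^2$. -/

import Mathlib

/-! ## The problem `d`-EDMC -/

namespace EDMC

/-- An `n × n` partial matrix over `ℝ`; `none` marks an unspecified entry. -/
abbrev PartialMatrix (n : ℕ) := Matrix (Fin n) (Fin n) (Option ℝ)

/-- `M` is a `G`-partial matrix: symmetric, zero on the diagonal, with nonnegative specified
entries, and the off-diagonal entry `ij` is specified if and only if `ij` is an edge of `G`. -/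
structure IsGPartial {n : ℕ} (G : SimpleGraph (Fin n)) (M : PartialMatrix n) : Prop where
  diag : ∀ i, M i i = some 0
  symm : ∀ i j, M i j = M j i
  nonneg : ∀ i j r, M i j = some r → 0 ≤ r
  specified_iff : ∀ i j, i ≠ j → ((M i j).isSome ↔ G.Adj i j)

/-- `D` is a Euclidean distance matrix in `ℝ^d`: its entries are the squared pairwise distances of
some points of `ℝ^d` (not necessarily distinct). -/
def IsEDM {n : ℕ} (d : ℕ) (D : Matrix (Fin n) (Fin n) ℝ) : Prop :=
  ∃ p : Fin n → EuclideanSpace ℝ (Fin d), ∀ i j, D i j = ‖p i - p j‖ ^ 2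

/-- `D` agrees with all specified entries of `M`. -/
def Completes {n : ℕ} (D : Matrix (Fin n) (Fin n) ℝ) (M : PartialMatrix n) : Prop :=
  ∀ i j r, M i j = some r → D i j = r

/-- `(M, d)` is a yes-instance of `d`-EDMC: `M` has a completion which is an EDM in `ℝ^d`. -/
def IsYes {n : ℕ} (M : PartialMatrix n) (d : ℕ) : Prop :=
  ∃ D : Matrix (Fin n) (Fin n) ℝ, IsEDM d D ∧ Completes D M

/-- The family of `k` vertex sets `C 0, …, C (k - 1)` is an edge clique cover of `G`. -/
structure IsEdgeCliqueCover {n k : ℕ} (G : SimpleGraph (Fin n)) (C : Fin k → Finset (Fin n)) :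
    Prop where
  isClique : ∀ i, G.IsClique (C i : Set (Fin n))
  covers : ∀ u v, G.Adj u v → ∃ i, u ∈ C i ∧ v ∈ C i

end EDMC

/-! ## The real RAM

The memory consists of registers for natural numbers and registers for real numbers, organized in
two-dimensional arrays whose entries are addressed indirectly, by computed indices. The name of an
array is a fixed number written in the program, so that a program uses finitely many arrays. On
natural numbers (used for indices, counters and flags) the machine can add, subtract and compare;
on real numbers it can add, subtract, multiply, divide and compare exactly. There is no rounding and
no other conversion from reals to natural numbers, there is no multiplication of natural numbers,
and the only real constants are `0` and `1`. Every operation, memory access, comparison, assignment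
and branching takes one unit of time. -/

namespace RealRAM

/-- A memory configuration: `s.nat a i j` and `s.real a i j` are the contents of entry `(i, j)` of
the array with name `a` of natural numbers and of real numbers, respectively. -/
structure State where
  nat : ℕ → ℕ → ℕ → ℕ
  real : ℕ → ℕ → ℕ → ℝ

/-- Expressions with a natural number as value. -/
inductive NExpr where
  | const (c : ℕ)
  | get (a : ℕ) (i j : NExpr)
  | add (e f : NExpr)
  | sub (e f : NExpr)

/-- Expressions with a real value. -/
inductive RExpr where
  | zero
  | one
  | get (a : ℕ) (i j : NExpr)
  | add (e f : RExpr)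
  | sub (e f : RExpr)
  | mul (e f : RExpr)
  | div (e f : RExpr)

/-- Tests. -/
inductive Test where
  | natLT (e f : NExpr)
  | natEq (e f : NExpr)
  | realLT (e f : RExpr)
  | realEq (e f : RExpr)
  | not (b : Test)
  | and (b c : Test)

/-- Programs. -/
inductive Prog where
  | skip
  | setNat (a : ℕ) (i j : NExpr) (e : NExpr)
  | setReal (a : ℕ) (i j : NExpr) (e : RExpr)
  | seq (p q : Prog)
  | ite (b : Test) (p q : Prog)
  | loop (b : Test) (p : Prog)

/-- Value of an expression; subtraction of natural numbers is truncated at `0`. -/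
def NExpr.eval (s : State) : NExpr → ℕ
  | const c => c
  | get a i j => s.nat a (i.eval s) (j.eval s)
  | add e f => e.eval s + f.eval s
  | sub e f => e.eval s - f.eval s

/-- Number of operations executed in evaluating an expression. -/
def NExpr.cost : NExpr → ℕ
  | const _ => 1
  | get _ i j => i.cost + j.cost + 1
  | add e f => e.cost + f.cost + 1
  | sub e f => e.cost + f.cost + 1

/-- Value of an expression; the result of a division by `0` is `0`. -/
noncomputable def RExpr.eval (s : State) : RExpr → ℝ
  | zero => 0
  | one => 1
  | get a i j => s.real a (i.eval s) (j.eval s)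
  | add e f => e.eval s + f.eval s
  | sub e f => e.eval s - f.eval s
  | mul e f => e.eval s * f.eval s
  | div e f => e.eval s / f.eval s

/-- Number of operations executed in evaluating an expression. -/
def RExpr.cost : RExpr → ℕ
  | zero => 1
  | one => 1
  | get _ i j => i.cost + j.cost + 1
  | add e f => e.cost + f.cost + 1
  | sub e f => e.cost + f.cost + 1
  | mul e f => e.cost + f.cost + 1
  | div e f => e.cost + f.cost + 1

/-- Truth of a test. -/
def Test.holds (s : State) : Test → Prop
  | natLT e f => e.eval s < f.eval s
  | natEq e f => e.eval s = f.eval s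
  | realLT e f => e.eval s < f.eval s
  | realEq e f => e.eval s = f.eval s
  | not b => ¬ b.holds s
  | and b c => b.holds s ∧ c.holds s

/-- Number of operations executed in evaluating a test. -/
def Test.cost : Test → ℕ
  | natLT e f => e.cost + f.cost + 1
  | natEq e f => e.cost + f.cost + 1
  | realLT e f => e.cost + f.cost + 1
  | realEq e f => e.cost + f.cost + 1
  | not b => b.cost + 1
  | and b c => b.cost + c.cost + 1

/-- Overwrite entry `(i, j)` of the array `a` of natural numbers by `v`. -/
def State.setNat (s : State) (a i j v : ℕ) : State where
  nat := fun a' i' j' => if a' = a ∧ i' = i ∧ j' = j then v else s.nat a' i' j'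
  real := s.real

/-- Overwrite entry `(i, j)` of the array `a` of real numbers by `v`. -/
noncomputable def State.setReal (s : State) (a i j : ℕ) (v : ℝ) : State where
  nat := s.nat
  real := fun a' i' j' => if a' = a ∧ i' = i ∧ j' = j then v else s.real a' i' j'

/-- `Runs p s t s'`: the program `p`, started in the memory configuration `s`, halts after exactly
`t` steps in the memory configuration `s'`. -/
inductive Runs : Prog → State → ℕ → State → Prop where
  | skip (s : State) : Runs .skip s 1 s
  | setNat (s : State) (a : ℕ) (i j e : NExpr) :
      Runs (.setNat a i j e) s (i.cost + j.cost + e.cost + 1)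
        (s.setNat a (i.eval s) (j.eval s) (e.eval s))
  | setReal (s : State) (a : ℕ) (i j : NExpr) (e : RExpr) :
      Runs (.setReal a i j e) s (i.cost + j.cost + e.cost + 1)
        (s.setReal a (i.eval s) (j.eval s) (e.eval s))
  | seq {p q : Prog} {s s₁ s₂ : State} {t₁ t₂ : ℕ} :
      Runs p s t₁ s₁ → Runs q s₁ t₂ s₂ → Runs (.seq p q) s (t₁ + t₂) s₂
  | iteTrue {b : Test} {p q : Prog} {s s' : State} {t : ℕ} :
      b.holds s → Runs p s t s' → Runs (.ite b p q) s (b.cost + 1 + t) s'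
  | iteFalse {b : Test} {p q : Prog} {s s' : State} {t : ℕ} :
      ¬ b.holds s → Runs q s t s' → Runs (.ite b p q) s (b.cost + 1 + t) s'
  | loopFalse {b : Test} {p : Prog} {s : State} :
      ¬ b.holds s → Runs (.loop b p) s (b.cost + 1) s
  | loopTrue {b : Test} {p : Prog} {s s₁ s₂ : State} {t₁ t₂ : ℕ} :
      b.holds s → Runs p s t₁ s₁ → Runs (.loop b p) s₁ t₂ s₂ →
        Runs (.loop b p) s (b.cost + 1 + t₁ + t₂) s₂

/-- The array whose entry `(0, 0)` is `v` and whose other entries are `0`. -/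
def scalar (v : ℕ) : ℕ → ℕ → ℕ := fun i j => if i = 0 ∧ j = 0 then v else 0

/-- The array which holds a finite matrix, and `0` outside of its range. -/
def tabulate {α : Type} [Zero α] {m n : ℕ} (f : Fin m → Fin n → α) : ℕ → ℕ → α :=
  fun i j => if h : i < m ∧ j < n then f ⟨i, h.1⟩ ⟨j, h.2⟩ else 0

end RealRAM

/-! ## Input and output of programs for `d`-EDMC

Arrays `0`, `1`, `2` of natural numbers hold the number `n` of rows, the dimension `d` and the
number `k` of cliques; array `3` holds the pattern of specified entries (which off the diagonal is
the adjacency matrix of the underlying graph); array `4` holds the incidence matrix of the cliques;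
array `0` of real numbers holds the specified entries. The answer is written to array `5` of natural
numbers. -/

namespace EDMC

open RealRAM

/-- `1` if the entry is specified, `0` otherwise. -/
def pattern {n : ℕ} (M : PartialMatrix n) (i j : Fin n) : ℕ := if (M i j).isSome then 1 else 0

/-- The initial memory for the input `(M, d)` with the cliques `C`; all cells that do not belong to
the input, and the cells of the unspecified entries, are `0`. -/
def inputState {n k : ℕ} (M : PartialMatrix n) (d : ℕ) (C : Fin k → Finset (Fin n)) : State where
  nat := fun a => match a with
    | 0 => scalar n
    | 1 => scalar d
    | 2 => scalar k
    | 3 => tabulate (pattern M)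
    | 4 => tabulate (fun (i : Fin k) (v : Fin n) => if v ∈ C i then 1 else 0)
    | _ => fun _ _ => 0
  real := fun a => match a with
    | 0 => tabulate (fun i j => (M i j).getD 0)
    | _ => fun _ _ => 0

/-- The memory `s` holds the instance `(M, d)`. -/
def HoldsInstance {n : ℕ} (s : State) (M : PartialMatrix n) (d : ℕ) : Prop :=
  s.nat 0 0 0 = n ∧ s.nat 1 0 0 = d ∧
    (∀ i j : Fin n, s.nat 3 i j = pattern M i j) ∧
    ∀ (i j : Fin n) (r : ℝ), M i j = some r → s.real 0 i j = r

/-- The answer written in the memory `s`: `0` for "no-instance", `1` for "yes-instance", `2` for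
"the instance held in the memory is the output". -/
def answer (s : State) : ℕ := s.nat 5 0 0

/-- The final memory `s` is a correct output on the instance `(M, d)`: either the instance is
solved, or the output is an equivalent instance `(M', d)` for a (nonempty) principal `n' × n'`
submatrix `M'` of `M` with `n' ≤ size`. -/
def IsCorrectOutput {n : ℕ} (M : PartialMatrix n) (d size : ℕ) (s : State) : Prop :=
  (answer s = 0 ∧ ¬ IsYes M d) ∨
  (answer s = 1 ∧ IsYes M d) ∨
  (answer s = 2 ∧ ∃ n' : ℕ, 1 ≤ n' ∧ n' ≤ size ∧ ∃ e : Fin n' ↪o Fin n,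
    HoldsInstance s (M.submatrix e e) d ∧ (IsYes M d ↔ IsYes (M.submatrix e e) d))

end EDMC

/-! Within a set `S` of vertices all of whose mutual squared distances are known, such as an
intersection of two cliques, fix a base point `b`. The numbers `D b v + D b u - D v u` are twice the
Gram matrix of the vectors `p v - p b`, for every realization `p` of `S`. If the rows indexed by `P
⊆ S` span all rows, then any realization of `{b} ∪ P` extends to `S`, and the positions of `b` and
`P` fix those of all other points (`determines_of_span`). If `S` is realizable in `ℝ^d`, the rank is
at most `d`, so that at most `d + 1` vertices are needed.

Take such a set for every ordered pair of cliques, equal indices included, and let `K` be their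
union; it has at most `(d + 1) * k ^ 2` elements. A realization of the submatrix on `K` extends to
each clique separately, by the pairs `(i, i)`. Extensions to `C i` and `C j` agree on the part of
`K` in `C i ∩ C j`, which contains a determining set, hence on all of `C i ∩ C j`. So they glue
(`exists_realizes_of_determines`), and every specified off-diagonal entry lies in a clique.

The set `P` comes from Gaussian elimination that skips vanishing pivots. On a Gram matrix this is
the Gram–Schmidt process (`elimRow_gram`): a vanishing pivot forces a vanishing row, and there are
at most `d` nonzero pivots. A violation of either property proves a no-instance. Otherwise the
vanishing of the rows without pivot already makes the pivot rows span (`determines_pivots`);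
realizability itself is never decided.

All loops have at most `n + k` iterations, which gives the time bound. -/

/-! ## Elimination on a symmetric matrix -/

namespace EDMC

open Finset

/-- Symmetric Gaussian elimination without pivoting, where vanishing pivots are skipped. -/
noncomputable def elimRow (g : ℕ → ℕ → ℝ) (v u : ℕ) : ℝ :=
  g v u - ∑ t : Fin v, elimRow g t v * elimRow g t u / elimRow g t t
termination_by v
decreasing_by all_goals exact t.2

theorem elimRow_eq (g : ℕ → ℕ → ℝ) (v u : ℕ) :
    elimRow g v u =
      g v u - ∑ t ∈ range v, elimRow g t v * elimRow g t u / elimRow g t t := by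
  rw [elimRow, Finset.sum_range]

theorem elimRow_eq_zero_right {g : ℕ → ℕ → ℝ} {u : ℕ} (h : ∀ v, g v u = 0) (v : ℕ) :
    elimRow g v u = 0 := by
  induction v using Nat.strong_induction_on with
  | _ v ih =>
    rw [elimRow_eq, h, Finset.sum_eq_zero]
    · simp
    · intro t ht
      simp [ih t (by simpa using ht)]

theorem elimRow_eq_zero_left {g : ℕ → ℕ → ℝ} {v : ℕ} (h : ∀ u, g v u = 0) (h' : ∀ u, g u v = 0)
    (u : ℕ) : elimRow g v u = 0 := by
  rw [elimRow_eq, h, Finset.sum_eq_zero]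
  · simp
  · intro t _
    simp [elimRow_eq_zero_right h']

/-! ### Elimination on a Gram matrix is Gram–Schmidt -/

section GramSchmidt

variable {E : Type*} [NormedAddCommGroup E] [InnerProductSpace ℝ E]

open InnerProductSpace

theorem inner_gramSchmidt_self (x : ℕ → E) (v : ℕ) :
    inner ℝ (gramSchmidt ℝ x v) (x v) = ‖gramSchmidt ℝ x v‖ ^ 2 := by
  conv_lhs => rw [gramSchmidt_def'' ℝ x v]
  rw [inner_add_right, inner_sum, Finset.sum_eq_zero, add_zero, real_inner_self_eq_norm_sq]
  intro t ht
  rw [inner_smul_right, gramSchmidt_orthogonal ℝ x (by simpa using (Finset.mem_Iio.1 ht).ne'),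
    mul_zero]

/-- Both sides obey the same recursion: subtracting earlier rows is subtracting projections onto
earlier Gram–Schmidt vectors. The factor 2 is kept because squared distances yield twice the Gram
matrix. -/
theorem elimRow_gram (x : ℕ → E) (v u : ℕ) :
    elimRow (fun v u => 2 * inner ℝ (x v) (x u)) v u = 2 * inner ℝ (gramSchmidt ℝ x v) (x u) := by
  induction v using Nat.strong_induction_on generalizing u with
  | _ v ih =>
    rw [elimRow_eq]
    have h := gramSchmidt_def'' ℝ x v
    have h' : gramSchmidt ℝ x v = x v - ∑ i ∈ Finset.Iio v,
      (inner ℝ (gramSchmidt ℝ x i) (x v) / ((‖gramSchmidt ℝ x i‖ : ℝ)) ^ 2) • gramSchmidt ℝ x i := by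
      rw [eq_sub_iff_add_eq]; exact h.symm
    rw [h', inner_sub_left, sum_inner, mul_sub, Finset.mul_sum]
    congr 1
    have hI : Finset.Iio v = range v := by ext; simp
    rw [hI]
    refine Finset.sum_congr rfl fun t ht => ?_
    have ht : t < v := by simpa using ht
    rw [ih t ht, ih t ht, ih t ht, inner_gramSchmidt_self, real_inner_smul_left]
    -- If the Gram–Schmidt vector is zero, both summands vanish; this is where skipping a pivot,
    -- through `x / 0 = 0`, matches skipping a projection.
    by_cases h0 : ‖gramSchmidt ℝ x t‖ = 0
    · simp [h0]
    · field_simp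

theorem elimRow_gram_self_eq_zero {x : ℕ → E} {v : ℕ}
    (h : elimRow (fun v u => 2 * inner ℝ (x v) (x u)) v v = 0) : gramSchmidt ℝ x v = 0 := by
  rw [elimRow_gram, inner_gramSchmidt_self] at h
  simpa using h

/-- Nonzero pivots belong to nonzero Gram–Schmidt vectors, which are pairwise orthogonal and so
linearly independent. -/
theorem card_pivots_le [FiniteDimensional ℝ E] (x : ℕ → E) (P : Finset ℕ)
    (hP : ∀ v ∈ P, elimRow (fun v u => 2 * inner ℝ (x v) (x u)) v v ≠ 0) :
    P.card ≤ Module.finrank ℝ E := by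
  have hli : LinearIndependent ℝ (fun v : P => gramSchmidt ℝ x v) := by
    refine linearIndependent_of_ne_zero_of_inner_eq_zero (𝕜 := ℝ) ?_ ?_
    · intro v hv
      refine hP v v.2 ?_
      rw [elimRow_gram, hv]; simp
    · intro v w hvw
      exact gramSchmidt_orthogonal ℝ x (fun h => hvw (Subtype.ext h))
  simpa using hli.fintype_card_le_finrank

end GramSchmidt

/-! ## Realizations -/

variable {V E : Type*} [NormedAddCommGroup E]

/-- The squared distances of the points `p v` with `v ∈ S` are prescribed by `D`. -/
def Realizes (D : V → V → ℝ) (S : Set V) (p : V → E) : Prop :=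
  ∀ u ∈ S, ∀ v ∈ S, ‖p u - p v‖ ^ 2 = D u v

theorem Realizes.mono {D : V → V → ℝ} {S T : Set V} {p : V → E} (h : Realizes D S p)
    (hT : T ⊆ S) : Realizes D T p :=
  fun u hu v hv => h u (hT hu) v (hT hv)

theorem Realizes.congr {D : V → V → ℝ} {S : Set V} {p q : V → E} (h : Realizes D S p)
    (hq : ∀ v ∈ S, q v = p v) : Realizes D S q := by
  intro u hu v hv
  rw [hq u hu, hq v hv, h u hu v hv]

variable [InnerProductSpace ℝ E]

/-- Twice the Gram matrix of the vectors from `b` to the points of `S`, computed from the squared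
distances, and `0` outside of `S`. -/
noncomputable def gram (D : V → V → ℝ) (S : Set V) (b v u : V) : ℝ :=
  open Classical in if v ∈ S ∧ u ∈ S then D b v + D b u - D v u else 0

theorem Realizes.gram_eq {D : V → V → ℝ} {S : Set V} {p : V → E} (h : Realizes D S p) {b v u : V}
    (hb : b ∈ S) (hv : v ∈ S) (hu : u ∈ S) :
    D b v + D b u - D v u = 2 * inner ℝ (p v - p b) (p u - p b) := by
  rw [← h b hb v hv, ← h b hb u hu, ← h v hv u hu, norm_sub_rev (p b) (p v),
    norm_sub_rev (p b) (p u)]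
  have : p v - p u = (p v - p b) - (p u - p b) := by abel
  rw [this, norm_sub_sq_real (p v - p b)]
  ring

/-- Realizations of `D` on `B` extend to `S`, and realizations on sets between `B` and `S` are
determined by their restrictions to `B`. -/
structure Determines (E : Type*) [NormedAddCommGroup E] [InnerProductSpace ℝ E]
    (D : V → V → ℝ) (B S : Set V) : Prop where
  subset : B ⊆ S
  extend : ∀ p : V → E, Realizes D B p → ∃ q : V → E, Realizes D S q ∧ ∀ v ∈ B, q v = p v
  -- Intermediate sets `T` are needed because the realization to be extended is given on the kept
  -- part of a clique, which may be larger than `B` and smaller than `S`.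
  unique : ∀ (T : Set V) (p q : V → E), B ⊆ T → T ⊆ S → Realizes D T p → Realizes D T q →
    (∀ v ∈ B, p v = q v) → ∀ v ∈ T, p v = q v

theorem determines_empty (D : V → V → ℝ) : Determines E D ∅ ∅ where
  subset := subset_rfl
  extend p h := ⟨p, h, fun _ _ => rfl⟩
  unique _ _ _ _ hT _ _ _ _ hv := (hT hv).elim

/-- Points are determined by a base point and points whose rows span the Gram matrix. -/
theorem determines_of_span {D : V → V → ℝ} {S : Set V} {b : V} {P : Finset V} (c : V → V → ℝ)
    (hb : b ∈ S) (hP : ∀ t ∈ P, t ∈ S) (hdiag : ∀ v ∈ S, D v v = 0)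
    (hsymm : ∀ u ∈ S, ∀ v ∈ S, D u v = D v u)
    (hc : ∀ v ∈ S, ∀ u ∈ S, D b v + D b u - D v u = ∑ t ∈ P, c v t * (D b t + D b u - D t u)) :
    Determines E D (insert b (P : Set V)) S := by
  have hPS : insert b (P : Set V) ⊆ S := Set.insert_subset hb hP
  have key : ∀ (T : Set V) (p : V → E), insert b (P : Set V) ⊆ T → T ⊆ S → Realizes D T p →
      ∀ v ∈ T, p v - p b = ∑ t ∈ P, c v t • (p t - p b) := by
    intro T p hBT hTS hp v hv
    have hbT : b ∈ T := hBT (Set.mem_insert _ _)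
    have hPT : ∀ t ∈ P, t ∈ T := fun t ht => hBT (Set.mem_insert_of_mem _ ht)
    -- The relation `hc` between rows makes `w` orthogonal to every `p u - p b` with `u ∈ T`. Since
    -- `w` is a combination of such vectors, it is zero.
    set w := p v - p b - ∑ t ∈ P, c v t • (p t - p b) with hw
    have horth : ∀ u ∈ T, inner ℝ w (p u - p b) = 0 := by
      intro u hu
      have h1 := hc v (hTS hv) u (hTS hu)
      rw [hp.gram_eq hbT hv hu] at h1
      have h2 : ∑ t ∈ P, c v t * (D b t + D b u - D t u) =
          2 * ∑ t ∈ P, c v t * inner ℝ (p t - p b) (p u - p b) := by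
        rw [Finset.mul_sum]
        refine Finset.sum_congr rfl fun t ht => ?_
        rw [hp.gram_eq hbT (hPT t ht) hu]; ring
      rw [hw, inner_sub_left, sum_inner]
      simp only [real_inner_smul_left]
      linarith
    have hw0 : inner ℝ w w = 0 := by
      conv_lhs => rw [hw]
      rw [inner_sub_right, inner_sum, ← hw, horth v hv, Finset.sum_eq_zero, sub_zero]
      intro t ht
      rw [inner_smul_right, horth t (hPT t ht), mul_zero]
    exact sub_eq_zero.1 (inner_self_eq_zero.1 hw0)
  refine ⟨hPS, ?_, ?_⟩
  · intro p hp
    -- The points off `B` are placed by the linear relations among the rows. Their inner products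
    -- come out right by applying `hc` to both arguments, with the symmetry of `D` in between; `D`
    -- need not be known to be realizable on `S`.
    set y : V → E := fun v => ∑ t ∈ P, c v t • (p t - p b) with hy
    have hB := key _ p subset_rfl hPS hp
    have hbB : b ∈ insert b (P : Set V) := Set.mem_insert _ _
    have hPB : ∀ t ∈ P, t ∈ insert b (P : Set V) := fun t ht => Set.mem_insert_of_mem _ ht
    have hin : ∀ u ∈ S, ∀ v ∈ S, D b u + D b v - D u v = 2 * inner ℝ (y u) (y v) := by
      intro u hu v hv
      rw [hc u hu v hv]
      simp only [hy]
      rw [sum_inner, Finset.mul_sum]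
      refine Finset.sum_congr rfl fun t ht => ?_
      have h1 := hc v hv t (hP t ht)
      have h2 : inner ℝ (p t - p b) (∑ s ∈ P, c v s • (p s - p b)) * 2 =
          ∑ s ∈ P, c v s * (D b s + D b t - D s t) := by
        rw [inner_sum, Finset.sum_mul]
        refine Finset.sum_congr rfl fun s hs => ?_
        rw [hp.gram_eq hbB (hPB s hs) (hPB t ht), real_inner_smul_right, real_inner_comm]
        ring
      rw [real_inner_smul_left, hsymm t (hP t ht) v hv]
      linear_combination c u t * h1 - c u t * h2
    refine ⟨fun v => p b + y v, ?_, ?_⟩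
    · intro u hu v hv
      have : p b + y u - (p b + y v) = y u - y v := by abel
      rw [this, norm_sub_sq_real, ← real_inner_self_eq_norm_sq, ← real_inner_self_eq_norm_sq]
      have h1 := hin u hu v hv
      have h2 := hin u hu u hu
      have h3 := hin v hv v hv
      rw [hdiag _ hu] at h2
      rw [hdiag _ hv] at h3
      linarith
    · intro v hv
      simp only [hy]
      rw [← hB v hv]; abel
  · intro T p q hBT hTS hp hq hpq v hv
    have h1 := key T p hBT hTS hp v hv
    have h2 := key T q hBT hTS hq v hv
    have h3 : ∑ t ∈ P, c v t • (p t - p b) = ∑ t ∈ P, c v t • (q t - q b) :=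
      Finset.sum_congr rfl fun t ht => by
        rw [hpq t (Set.mem_insert_of_mem _ ht), hpq b (Set.mem_insert _ _)]
    rw [h3, ← h2, hpq b (Set.mem_insert _ _)] at h1
    exact sub_left_injective h1

/-- Realizations of a part of each clique glue to a realization of all cliques, if the part contains
sets which determine the pairwise intersections of the cliques. -/
theorem exists_realizes_of_determines {ι : Type*} {D : V → V → ℝ} {C : ι → Set V} {K : Set V}
    {B : ι → ι → Set V} (hBK : ∀ i j, B i j ⊆ K) (hB : ∀ i j, Determines E D (B i j) (C i ∩ C j))
    {p : V → E} (hp : ∀ i, Realizes D (K ∩ C i) p) :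
    ∃ q : V → E, ∀ i, Realizes D (C i) q := by
  have hext : ∀ i, ∃ r : V → E, Realizes D (C i) r ∧ ∀ v ∈ K ∩ C i, r v = p v := by
    intro i
    have hBi := hB i i
    rw [Set.inter_self] at hBi
    have hsub : B i i ⊆ K ∩ C i := Set.subset_inter (hBK i i) hBi.subset
    obtain ⟨r, hr, hrB⟩ := hBi.extend p ((hp i).mono hsub)
    -- The extension is built from `B i i` alone; uniqueness on `K ∩ C i` shows that it keeps all
    -- the given points of the clique.
    exact ⟨r, hr, hBi.unique _ r p hsub Set.inter_subset_right (hr.mono Set.inter_subset_right)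
      (hp i) hrB⟩
  choose r hr hrp using hext
  have hagree : ∀ i j, ∀ v ∈ C i ∩ C j, r i v = r j v := by
    intro i j
    refine (hB i j).unique _ _ _ (hB i j).subset subset_rfl ((hr i).mono Set.inter_subset_left)
      ((hr j).mono Set.inter_subset_right) fun v hv => ?_
    rw [hrp i v ⟨hBK i j hv, ((hB i j).subset hv).1⟩, hrp j v ⟨hBK i j hv, ((hB i j).subset hv).2⟩]
  classical
  refine ⟨fun v => if h : ∃ i, v ∈ C i then r h.choose v else 0, fun i => (hr i).congr ?_⟩
  intro v hv
  have h : ∃ i, v ∈ C i := ⟨i, hv⟩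
  rw [dif_pos h]
  exact hagree _ _ v ⟨h.choose_spec, hv⟩

/-! ## Elimination on the Gram matrix -/

theorem Realizes.gram_eq_inner {D : ℕ → ℕ → ℝ} {S : Set ℕ} {p : ℕ → E} (h : Realizes D S p)
    {b : ℕ} (hb : b ∈ S) : ∃ x : ℕ → E, gram D S b = fun v u => 2 * inner ℝ (x v) (x u) := by
  classical
  refine ⟨fun v => if v ∈ S then p v - p b else 0, ?_⟩
  funext v u
  by_cases hv : v ∈ S <;> by_cases hu : u ∈ S <;> simp [gram, hv, hu]
  exact h.gram_eq hb hv hu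

theorem Realizes.elimRow_eq_zero {D : ℕ → ℕ → ℝ} {S : Set ℕ} {p : ℕ → E} (h : Realizes D S p)
    {b : ℕ} (hb : b ∈ S) {v : ℕ} (hv : elimRow (gram D S b) v v = 0) (u : ℕ) :
    elimRow (gram D S b) v u = 0 := by
  obtain ⟨x, hx⟩ := h.gram_eq_inner hb
  rw [hx] at hv ⊢
  rw [elimRow_gram, elimRow_gram_self_eq_zero hv]
  simp

theorem Realizes.card_pivots_le [FiniteDimensional ℝ E] {D : ℕ → ℕ → ℝ} {S : Set ℕ} {p : ℕ → E}
    (h : Realizes D S p) {b : ℕ} (hb : b ∈ S) {P : Finset ℕ}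
    (hP : ∀ v ∈ P, elimRow (gram D S b) v v ≠ 0) : P.card ≤ Module.finrank ℝ E := by
  obtain ⟨x, hx⟩ := h.gram_eq_inner hb
  rw [hx] at hP
  exact EDMC.card_pivots_le x P hP

theorem elimRow_gram_of_notMem_right {D : ℕ → ℕ → ℝ} {S : Set ℕ} {b u : ℕ} (hu : u ∉ S) (v : ℕ) :
    elimRow (gram D S b) v u = 0 :=
  elimRow_eq_zero_right (by simp [gram, hu]) v

theorem elimRow_gram_of_notMem_left {D : ℕ → ℕ → ℝ} {S : Set ℕ} {b v : ℕ} (hv : v ∉ S) (u : ℕ) :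
    elimRow (gram D S b) v u = 0 :=
  elimRow_eq_zero_left (by simp [gram, hv]) (by simp [gram, hv]) u

/-- Each row of the Gram matrix is a combination of eliminated rows. By induction these lie in the
span of the original pivot rows: without a pivot they vanish, and with one they are the original row
minus earlier eliminated rows. The hypothesis `h` replaces positive semidefiniteness and can be
tested by the machine. -/
theorem determines_pivots {D : ℕ → ℕ → ℝ} {S : Set ℕ} {b : ℕ} {P : Finset ℕ} (hb : b ∈ S)
    (hP : ∀ v, v ∈ P ↔ v ∈ S ∧ elimRow (gram D S b) v v ≠ 0) (hdiag : ∀ v ∈ S, D v v = 0)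
    (hsymm : ∀ u ∈ S, ∀ v ∈ S, D u v = D v u)
    (h : ∀ v ∈ S, ∀ u ∈ S, elimRow (gram D S b) v v = 0 → elimRow (gram D S b) v u = 0) :
    Determines E D (insert b (P : Set ℕ)) S := by
  set g := gram D S b with hg
  have h0 : ∀ v, v ∉ P → elimRow g v = 0 := by
    intro v hvP
    funext u
    by_cases hv : v ∈ S
    · by_cases hu : u ∈ S
      · exact h v hv u hu (by_contra fun h' => hvP ((hP v).2 ⟨hv, h'⟩))
      · exact elimRow_gram_of_notMem_right hu v
    · exact elimRow_gram_of_notMem_left hv u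
  have hrow : ∀ v, g v = elimRow g v +
      ∑ t ∈ range v, (elimRow g t v / elimRow g t t) • elimRow g t := by
    intro v
    funext u
    simp only [Pi.add_apply, Finset.sum_apply, Pi.smul_apply, smul_eq_mul]
    rw [elimRow_eq g v u, eq_comm, sub_add_eq_add_sub, sub_eq_iff_eq_add]
    congr 1
    exact Finset.sum_congr rfl fun t _ => by ring
  set W := Submodule.span ℝ (g '' (P : Set ℕ)) with hW
  have hL : ∀ v, elimRow g v ∈ W := by
    intro v
    induction v using Nat.strong_induction_on with
    | _ v ih =>
      by_cases hv : v ∈ P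
      · have h1 := hrow v
        rw [← sub_eq_iff_eq_add] at h1
        rw [← h1]
        exact W.sub_mem (Submodule.subset_span ⟨v, hv, rfl⟩)
          (W.sum_mem fun t ht => W.smul_mem _ (ih t (by simpa using ht)))
      · rw [h0 v hv]; exact W.zero_mem
  have hmem : ∀ v, g v ∈ W := by
    intro v
    rw [hrow v]
    exact W.add_mem (hL v) (W.sum_mem fun t _ => W.smul_mem _ (hL t))
  have hc : ∀ v, ∃ c : ℕ → ℝ, ∑ t ∈ P, c t • g t = g v := by
    intro v
    have := hmem v
    rw [hW, Submodule.mem_span_image_finset_iff_exists_fun] at this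
    obtain ⟨c, hc⟩ := this
    refine ⟨fun t => if h : t ∈ P then c ⟨t, h⟩ else 0, ?_⟩
    rw [← hc, ← Finset.sum_coe_sort]
    exact Finset.sum_congr rfl fun t _ => by simp
  choose c hc using hc
  refine determines_of_span c hb (fun t ht => ((hP t).1 ht).1) hdiag hsymm ?_
  intro v hv u hu
  have h1 := congrFun (hc v) u
  simp only [Finset.sum_apply, Pi.smul_apply, smul_eq_mul] at h1
  have h2 : D b v + D b u - D v u = g v u := by simp [hg, gram, hv, hu]
  rw [h2, ← h1]
  refine Finset.sum_congr rfl fun t ht => ?_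
  simp [hg, gram, ((hP t).1 ht).1, hu]

end EDMC

/-! ## Correctness and running time of programs -/

namespace RealRAM

/-- A bound for the running time of a program each of whose loops makes at most `X` iterations. -/
noncomputable def Prog.timePoly : Prog → Polynomial ℕ
  | skip => 1
  | setNat _ i j e => Polynomial.C (i.cost + j.cost + e.cost + 1)
  | setReal _ i j e => Polynomial.C (i.cost + j.cost + e.cost + 1)
  | seq p q => p.timePoly + q.timePoly
  | ite b p q => Polynomial.C (b.cost + 1) + p.timePoly + q.timePoly
  | loop b p => Polynomial.X * (Polynomial.C (b.cost + 1) + p.timePoly) + Polynomial.C (b.cost + 1)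

/-- The arrays of natural numbers which a program may change. -/
def Prog.natWrites : Prog → List ℕ
  | skip => []
  | setNat a _ _ _ => [a]
  | setReal _ _ _ _ => []
  | seq p q => p.natWrites ++ q.natWrites
  | ite _ p q => p.natWrites ++ q.natWrites
  | loop _ p => p.natWrites

/-- The arrays of real numbers which a program may change. -/
def Prog.realWrites : Prog → List ℕ
  | skip => []
  | setNat _ _ _ _ => []
  | setReal a _ _ _ => [a]
  | seq p q => p.realWrites ++ q.realWrites
  | ite _ p q => p.realWrites ++ q.realWrites
  | loop _ p => p.realWrites

/-- The memories `s` and `s'` agree on all arrays that `p` cannot change. -/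
structure Frame (p : Prog) (s s' : State) : Prop where
  nat : ∀ a, a ∉ p.natWrites → s'.nat a = s.nat a
  real : ∀ a, a ∉ p.realWrites → s'.real a = s.real a

/-! ### Memory updates and unchanged arrays -/

theorem State.setNat_nat (s : State) (a i j v a' i' j' : ℕ) :
    (s.setNat a i j v).nat a' i' j' = if a' = a ∧ i' = i ∧ j' = j then v else s.nat a' i' j' := rfl

theorem State.setNat_nat_of_ne (s : State) {a a' : ℕ} (h : a' ≠ a) (i j v : ℕ) :
    (s.setNat a i j v).nat a' = s.nat a' := by
  funext i' j'
  simp [State.setNat_nat, h]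

@[simp] theorem State.setNat_real (s : State) (a i j v : ℕ) :
    (s.setNat a i j v).real = s.real := rfl

theorem State.setReal_real (s : State) (a i j : ℕ) (v : ℝ) (a' i' j' : ℕ) :
    (s.setReal a i j v).real a' i' j' = if a' = a ∧ i' = i ∧ j' = j then v else s.real a' i' j' :=
  rfl

theorem State.setReal_real_of_ne (s : State) {a a' : ℕ} (h : a' ≠ a) (i j : ℕ) (v : ℝ) :
    (s.setReal a i j v).real a' = s.real a' := by
  funext i' j'
  simp [State.setReal_real, h]

@[simp] theorem State.setReal_nat (s : State) (a i j : ℕ) (v : ℝ) :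
    (s.setReal a i j v).nat = s.nat := rfl

theorem Frame.refl (p : Prog) (s : State) : Frame p s s := ⟨fun _ _ => rfl, fun _ _ => rfl⟩

theorem Frame.trans {p : Prog} {s₁ s₂ s₃ : State} (h : Frame p s₁ s₂) (h' : Frame p s₂ s₃) :
    Frame p s₁ s₃ :=
  ⟨fun a ha => (h'.nat a ha).trans (h.nat a ha), fun a ha => (h'.real a ha).trans (h.real a ha)⟩

theorem Frame.mono {p q : Prog} {s s' : State} (h : Frame p s s')
    (hn : p.natWrites ⊆ q.natWrites) (hr : p.realWrites ⊆ q.realWrites) : Frame q s s' :=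
  ⟨fun a ha => h.nat a fun h' => ha (hn h'), fun a ha => h.real a fun h' => ha (hr h')⟩

theorem Runs.frame {p : Prog} {s s' : State} {t : ℕ} (h : Runs p s t s') : Frame p s s' := by
  induction h with
  | skip s => exact Frame.refl _ _
  | setNat s a i j e =>
    refine ⟨fun a' ha => State.setNat_nat_of_ne s (by simpa [Prog.natWrites] using ha) _ _ _,
      fun _ _ => rfl⟩
  | setReal s a i j e =>
    refine ⟨fun _ _ => rfl,
      fun a' ha => State.setReal_real_of_ne s (by simpa [Prog.realWrites] using ha) _ _ _⟩
  | seq _ _ ih₁ ih₂ =>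
    exact (ih₁.mono (by simp [Prog.natWrites]) (by simp [Prog.realWrites])).trans
      (ih₂.mono (by simp [Prog.natWrites]) (by simp [Prog.realWrites]))
  | iteTrue _ _ ih => exact ih.mono (by simp [Prog.natWrites]) (by simp [Prog.realWrites])
  | iteFalse _ _ ih => exact ih.mono (by simp [Prog.natWrites]) (by simp [Prog.realWrites])
  | loopFalse _ => exact Frame.refl _ _
  | loopTrue _ _ _ ih₁ ih₂ =>
    exact Frame.trans ⟨ih₁.nat, ih₁.real⟩ ih₂

/-- Started in `s`, the program `p` halts within the time that it takes if each of its loops makes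
at most `x` iterations, and the final memory satisfies `Q`. -/
def Does (x : ℕ) (p : Prog) (s : State) (Q : State → Prop) : Prop :=
  ∃ t s', Runs p s t s' ∧ t ≤ p.timePoly.eval x ∧ Q s'

/-! ### Rules for correctness and running time together -/

section Does

variable {x : ℕ} {s : State} {Q R : State → Prop}

theorem Does.imp {p : Prog} (h : Does x p s Q) (h' : ∀ s', Q s' → Frame p s s' → R s') :
    Does x p s R := by
  obtain ⟨t, s', hr, ht, hQ⟩ := h
  exact ⟨t, s', hr, ht, h' s' hQ hr.frame⟩

theorem does_skip (h : Q s) : Does x .skip s Q :=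
  ⟨_, _, .skip s, by simp [Prog.timePoly], h⟩

theorem does_setNat {a : ℕ} {i j e : NExpr} (h : Q (s.setNat a (i.eval s) (j.eval s) (e.eval s))) :
    Does x (.setNat a i j e) s Q :=
  ⟨_, _, .setNat s a i j e, by simp [Prog.timePoly], h⟩

theorem does_setReal {a : ℕ} {i j : NExpr} {e : RExpr}
    (h : Q (s.setReal a (i.eval s) (j.eval s) (e.eval s))) : Does x (.setReal a i j e) s Q :=
  ⟨_, _, .setReal s a i j e, by simp [Prog.timePoly], h⟩

theorem does_seq {p q : Prog} (h : Does x p s fun s' => Does x q s' Q) : Does x (.seq p q) s Q := by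
  obtain ⟨t₁, s₁, hr₁, ht₁, t₂, s₂, hr₂, ht₂, hQ⟩ := h
  refine ⟨_, _, .seq hr₁ hr₂, ?_, hQ⟩
  simp only [Prog.timePoly, Polynomial.eval_add]
  omega

theorem does_ite {b : Test} {p q : Prog} (ht : b.holds s → Does x p s Q)
    (hf : ¬ b.holds s → Does x q s Q) : Does x (.ite b p q) s Q := by
  by_cases hb : b.holds s
  · obtain ⟨t, s', hr, ht, hQ⟩ := ht hb
    refine ⟨_, _, .iteTrue hb hr, ?_, hQ⟩
    simp only [Prog.timePoly, Polynomial.eval_add, Polynomial.eval_C]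
    omega
  · obtain ⟨t, s', hr, ht, hQ⟩ := hf hb
    refine ⟨_, _, .iteFalse hb hr, ?_, hQ⟩
    simp only [Prog.timePoly, Polynomial.eval_add, Polynomial.eval_C]
    omega

/-- Entry `(0, 0)` of an array. -/
def NExpr.var (a : ℕ) : NExpr := .get a (.const 0) (.const 0)

@[simp] theorem NExpr.eval_var (s : State) (a : ℕ) : (NExpr.var a).eval s = s.nat a 0 0 := rfl

/-- `ite` without an alternative. -/
def Prog.when (b : Test) (p : Prog) : Prog := .ite b p .skip

theorem does_when {b : Test} {p : Prog} (ht : b.holds s → Does x p s Q)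
    (hf : ¬ b.holds s → Q s) : Does x (.when b p) s Q :=
  does_ite ht fun h => does_skip (hf h)

/-- Execute `p` with the counter `c` running over the numbers smaller than `N`. -/
def Prog.for (c : ℕ) (N : NExpr) (p : Prog) : Prog :=
  .seq (.setNat c (.const 0) (.const 0) (.const 0))
    (.loop (.natLT (.var c) N)
      (.seq p (.setNat c (.const 0) (.const 0) (.add (.var c) (.const 1)))))

theorem does_loop {b : Test} {p : Prog} (I : ℕ → State → Prop) {m : ℕ} (hm : m ≤ x) (h0 : I 0 s)
    (hstep : ∀ i s', i < m → I i s' → b.holds s' ∧ Does x p s' (I (i + 1)))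
    (hend : ∀ s', I m s' → ¬ b.holds s' ∧ Q s') : Does x (.loop b p) s Q := by
  -- Induction on the number `r` of iterations that remain.
  have key : ∀ r s', r ≤ m → I (m - r) s' → ∃ t s'', Runs (.loop b p) s' t s'' ∧
      t ≤ r * (b.cost + 1 + p.timePoly.eval x) + (b.cost + 1) ∧ Q s'' := by
    intro r
    induction r with
    | zero =>
      intro s' _ hI
      obtain ⟨h1, h2⟩ := hend s' hI
      exact ⟨_, _, .loopFalse h1, by simp, h2⟩
    | succ r ih =>
      intro s' hr hI
      obtain ⟨h1, t₁, s₁, hr₁, ht₁, hI₁⟩ := hstep _ _ (by omega) hI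
      rw [show m - (r + 1) + 1 = m - r by omega] at hI₁
      obtain ⟨t₂, s₂, hr₂, ht₂, hQ⟩ := ih s₁ (by omega) hI₁
      refine ⟨_, _, .loopTrue h1 hr₁ hr₂, ?_, hQ⟩
      rw [add_mul, one_mul]
      omega
  obtain ⟨t, s', hr, ht, hQ⟩ := key m s le_rfl (by simpa using h0)
  refine ⟨t, s', hr, ht.trans ?_, hQ⟩
  simp only [Prog.timePoly, Polynomial.eval_add, Polynomial.eval_C, Polynomial.eval_mul,
    Polynomial.eval_X]
  gcongr

/-- The invariant is required after the increment of the counter. The bound `N` may be any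
expression that keeps its value while only arrays written by the loop change. -/
theorem does_for {c : ℕ} {N : NExpr} {p : Prog} (I : ℕ → State → Prop) {m : ℕ}
    (hc : c ∉ p.natWrites) (hm : m ≤ x)
    (hN : ∀ s', Frame (.for c N p) s s' → N.eval s' = m)
    (h0 : I 0 (s.setNat c 0 0 0))
    (hstep : ∀ i s', i < m → Frame (.for c N p) s s' → s'.nat c 0 0 = i → I i s' →
      Does x p s' fun s'' => I (i + 1) (s''.setNat c 0 0 (i + 1)))
    (hQ : ∀ s', Frame (.for c N p) s s' → I m s' → Q s') : Does x (.for c N p) s Q := by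
  have hset : ∀ s' v, Frame (.for c N p) s' (s'.setNat c 0 0 v) := by
    intro s' v
    refine ⟨fun a ha => State.setNat_nat_of_ne s' ?_ _ _ _, fun _ _ => rfl⟩
    rintro rfl
    simp [Prog.for, Prog.natWrites] at ha
  refine does_seq (does_setNat ?_)
  refine does_loop (fun i s' => I i s' ∧ s'.nat c 0 0 = i ∧ Frame (.for c N p) s s') hm
    ⟨h0, by simp [State.setNat_nat, NExpr.eval], hset s 0⟩ ?_ ?_
  · rintro i s' hi ⟨hI, hci, hfr⟩
    refine ⟨?_, does_seq ((hstep i s' hi hfr hci hI).imp fun s'' hI' hfr' => does_setNat ?_)⟩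
    · simp [Test.holds, hN s' hfr, hci, hi]
    · have hci' : s''.nat c 0 0 = i := by rw [hfr'.nat c hc, hci]
      simp only [NExpr.eval, NExpr.eval_var, hci']
      refine ⟨hI', by simp [State.setNat_nat], (hfr.trans (hfr'.mono ?_ ?_)).trans (hset s'' _)⟩
      · simp [Prog.for, Prog.natWrites]
      · simp [Prog.for, Prog.realWrites]
  · rintro s' ⟨hI, hci, hfr⟩
    exact ⟨by simp [Test.holds, hN s' hfr, hci], hQ s' hfr hI⟩

end Does

end RealRAM

/-! ## The kernelization program

Further arrays of natural numbers: `6` is the rejection flag, `7` holds the set of kept vertices, `8`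
the base point, `9` the number of pivots, `10` and `11` the number and the list of the kept vertices,
`12` is a copy of the pattern, and the arrays from `20` on are loop counters. Array `1` of real
numbers holds the rows of the elimination, array `2` is a copy of the entries. -/

namespace EDMC

open RealRAM

/-- The intersection of the two cliques with the current indices. -/
def cliqueInter (s : State) : Set ℕ :=
  {v | s.nat 4 (s.nat 20 0 0) v = 1 ∧ s.nat 4 (s.nat 21 0 0) v = 1}

theorem cliqueInter_congr {p : Prog} {s s' : State} (h : Frame p s s') (h4 : 4 ∉ p.natWrites)
    (h20 : 20 ∉ p.natWrites) (h21 : 21 ∉ p.natWrites) : cliqueInter s' = cliqueInter s := by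
  simp [cliqueInter, h.nat 4 h4, h.nat 20 h20, h.nat 21 h21]

/-- Test for membership in `cliqueInter`. -/
def inBoth (v : NExpr) : Test :=
  .and (.natEq (.get 4 (.var 20) v) (.const 1)) (.natEq (.get 4 (.var 21) v) (.const 1))

@[simp] theorem holds_inBoth (s : State) (v : NExpr) :
    (inBoth v).holds s ↔ v.eval s ∈ cliqueInter s := by
  simp [inBoth, Test.holds, NExpr.eval, cliqueInter]

/-- Choose a base point of the intersection. -/
def chooseBase : Prog :=
  .for 22 (.var 0) (.when (inBoth (.var 22)) (.setNat 8 (.const 0) (.const 0) (.var 22)))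

/-- For an empty intersection the register keeps an old value, so membership of the base point is
claimed only if the intersection has an element. -/
theorem does_chooseBase {x : ℕ} {s : State} (hn : s.nat 0 0 0 ≤ x) :
    Does x chooseBase s fun s' =>
      ∀ v < s.nat 0 0 0, v ∈ cliqueInter s → s'.nat 8 0 0 ∈ cliqueInter s := by
  refine does_for (fun i s' => ∀ v < i, v ∈ cliqueInter s → s'.nat 8 0 0 ∈ cliqueInter s)
    (by decide) hn (fun s' h => by rw [NExpr.eval_var, h.nat 0 (by decide)]) (by simp) ?_
    (fun s' _ h => h)
  intro i s' _ hfr hc hI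
  have hS := cliqueInter_congr hfr (by decide) (by decide) (by decide)
  refine does_when (fun h => does_setNat ?_) (fun h => ?_)
  · intro v _ _
    simp only [holds_inBoth, NExpr.eval_var, hS, hc] at h
    simpa [State.setNat_nat, NExpr.eval, hc] using h
  · intro v hv hvS
    simp only [holds_inBoth, NExpr.eval_var, hS, hc] at h
    have : v < i := by
      rcases Nat.lt_succ_iff_lt_or_eq.1 hv with h' | rfl
      · exact h'
      · exact (h hvS).elim
    simpa [State.setNat_nat] using hI v this hvS

/-- The Gram matrix of the current intersection. -/
noncomputable def curGram (s : State) : ℕ → ℕ → ℝ :=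
  gram (s.real 0) (cliqueInter s) (s.nat 8 0 0)

theorem curGram_congr {p : Prog} {s s' : State} (h : Frame p s s') (h0 : 0 ∉ p.realWrites)
    (h4 : 4 ∉ p.natWrites) (h8 : 8 ∉ p.natWrites) (h20 : 20 ∉ p.natWrites)
    (h21 : 21 ∉ p.natWrites) : curGram s' = curGram s := by
  simp [curGram, cliqueInter_congr h h4 h20 h21, h.real 0 h0, h.nat 8 h8]

/-- Write an entry of the Gram matrix. -/
def initEntry : Prog :=
  .ite (.and (inBoth (.var 22)) (inBoth (.var 23)))
    (.setReal 1 (.var 22) (.var 23) (.sub (.add (.get 0 (.var 8) (.var 22))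
      (.get 0 (.var 8) (.var 23))) (.get 0 (.var 22) (.var 23))))
    (.setReal 1 (.var 22) (.var 23) .zero)

theorem does_initEntry {x : ℕ} {s : State} :
    Does x initEntry s fun s' => s' = s.setReal 1 (s.nat 22 0 0) (s.nat 23 0 0)
      (curGram s (s.nat 22 0 0) (s.nat 23 0 0)) := by
  refine does_ite (fun h => does_setReal ?_) (fun h => does_setReal ?_) <;>
  · simp only [Test.holds, holds_inBoth, NExpr.eval_var] at h
    simp [RExpr.eval, curGram, gram, h]

/-- Subtract the contributions of the previous rows from an entry. -/
def reduceEntry : Prog :=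
  .for 24 (.var 22) (.setReal 1 (.var 22) (.var 23) (.sub (.get 1 (.var 22) (.var 23))
    (.div (.mul (.get 1 (.var 24) (.var 22)) (.get 1 (.var 24) (.var 23)))
      (.get 1 (.var 24) (.var 24)))))

/-- The earlier rows must be complete, since reducing entry `(v, u)` reads columns `t`, `v` and `u`
of row `t` for each `t < v`. -/
theorem does_reduceEntry {x v u n : ℕ} {s : State} {g : ℕ → ℕ → ℝ} (hv : s.nat 22 0 0 = v)
    (hu : s.nat 23 0 0 = u) (hvn : v < n) (hun : u < n) (hn : n ≤ x)
    (hrow : ∀ w < v, ∀ z < n, s.real 1 w z = elimRow g w z) (hg : s.real 1 v u = g v u) :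
    Does x reduceEntry s fun s' => s'.real 1 v u = elimRow g v u ∧
      ∀ w z, (w ≠ v ∨ z ≠ u) → s'.real 1 w z = s.real 1 w z := by
  refine does_for (m := v) (fun i s' => s'.real 1 v u = g v u -
      ∑ t ∈ Finset.range i, elimRow g t v * elimRow g t u / elimRow g t t ∧
      ∀ w z, (w ≠ v ∨ z ≠ u) → s'.real 1 w z = s.real 1 w z)
    (by decide) (by omega) (fun s' h => by rw [NExpr.eval_var, h.nat 22 (by decide), hv])
    (by simp [hg]) ?_ (fun s' _ h => by rw [elimRow_eq]; exact h)
  rintro i s' hi hfr hc ⟨hI, hI'⟩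
  have hv' : s'.nat 22 0 0 = v := by rw [hfr.nat 22 (by decide), hv]
  have hu' : s'.nat 23 0 0 = u := by rw [hfr.nat 23 (by decide), hu]
  have hi' : ∀ z < n, s'.real 1 i z = elimRow g i z := fun z hz => by
    rw [hI' i z (Or.inl hi.ne), hrow i hi z hz]
  refine does_setReal ⟨?_, ?_⟩
  · simp only [State.setNat_real, State.setReal_real, NExpr.eval_var, RExpr.eval, hv', hu', hc, hI,
      hi' v hvn, hi' u hun, hi' i (hi.trans hvn), Finset.sum_range_succ]
    simp only [and_self, if_true]
    ring
  · intro w z hwz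
    have : ¬ (w = v ∧ z = u) := by tauto
    simp only [State.setNat_real, State.setReal_real, NExpr.eval_var, hv', hu', true_and, this,
      if_false]
    exact hI' w z hwz

/-- Elimination on the Gram matrix. -/
def eliminate : Prog :=
  .for 22 (.var 0) (.for 23 (.var 0) (.seq initEntry reduceEntry))

theorem does_eliminate {x : ℕ} {s : State} (hn : s.nat 0 0 0 ≤ x) :
    Does x eliminate s fun s' => ∀ v < s.nat 0 0 0, ∀ u < s.nat 0 0 0,
      s'.real 1 v u = elimRow (curGram s) v u := by
  refine does_for (fun i s' => ∀ v < i, ∀ u < s.nat 0 0 0, s'.real 1 v u = elimRow (curGram s) v u)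
    (by decide) hn (fun s' h => by rw [NExpr.eval_var, h.nat 0 (by decide)]) (by simp) ?_
    (fun s' _ h => h)
  intro v s₁ hv hfr₁ hv₁ hI
  refine does_for (m := s.nat 0 0 0) (fun i s' => (∀ w < v, ∀ u < s.nat 0 0 0,
      s'.real 1 w u = elimRow (curGram s) w u) ∧ ∀ u < i, s'.real 1 v u = elimRow (curGram s) v u)
    (by decide) hn
    (fun s' h => by rw [NExpr.eval_var, h.nat 0 (by decide), hfr₁.nat 0 (by decide)])
    ⟨by simpa using hI, by simp⟩ ?_ ?_
  · rintro u s₂ hu hfr₂ hu₂ ⟨hI₁, hI₂⟩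
    have hv₂ : s₂.nat 22 0 0 = v := by rw [hfr₂.nat 22 (by decide), hv₁]
    have hg : curGram s₂ = curGram s := by
      rw [curGram_congr hfr₂ (by decide) (by decide) (by decide) (by decide) (by decide),
        curGram_congr hfr₁ (by decide) (by decide) (by decide) (by decide) (by decide)]
    refine does_seq (does_initEntry.imp fun s₃ h₃ _ => ?_)
    rw [hv₂, hu₂, hg] at h₃
    refine (does_reduceEntry (g := curGram s) (v := v) (u := u) (n := s.nat 0 0 0) (by simp [h₃, hv₂])
      (by simp [h₃, hu₂]) hv hu hn ?_ (by simp [h₃, State.setReal_real])).imp ?_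
    · intro w hw z hz
      simp [h₃, State.setReal_real, hw.ne, hI₁ w hw z hz]
    · rintro s₄ ⟨h, h'⟩ _
      refine ⟨fun w hw z hz => ?_, fun z hz => ?_⟩
      · rw [State.setNat_real, h' w z (Or.inl hw.ne), h₃]
        simp [State.setReal_real, hw.ne, hI₁ w hw z hz]
      · rw [State.setNat_real]
        rcases Nat.lt_succ_iff_lt_or_eq.1 hz with hz' | rfl
        · rw [h' v z (Or.inr hz'.ne), h₃]
          simp [State.setReal_real, hz'.ne, hI₂ z hz']
        · exact h
  · rintro s' _ ⟨h₁, h₂⟩ w hw u hu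
    rw [State.setNat_real]
    rcases Nat.lt_succ_iff_lt_or_eq.1 hw with hw' | rfl
    · exact h₁ w hw' u hu
    · exact h₂ u hu

/-- Reject if a row with vanishing pivot does not vanish. -/
def checkRows : Prog :=
  .for 22 (.var 0) (.for 23 (.var 0)
    (.when (.and (.realEq (.get 1 (.var 22) (.var 22)) .zero)
      (.not (.realEq (.get 1 (.var 22) (.var 23)) .zero)))
      (.setNat 6 (.const 0) (.const 0) (.const 1))))

theorem does_checkRows {x : ℕ} {s : State} (hn : s.nat 0 0 0 ≤ x) :
    Does x checkRows s fun s' => s'.nat 6 0 0 = 0 ↔ s.nat 6 0 0 = 0 ∧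
      ∀ v < s.nat 0 0 0, ∀ u < s.nat 0 0 0, s.real 1 v v = 0 → s.real 1 v u = 0 := by
  refine does_for (fun i s' => s'.nat 6 0 0 = 0 ↔ s.nat 6 0 0 = 0 ∧
      ∀ v < i, ∀ u < s.nat 0 0 0, s.real 1 v v = 0 → s.real 1 v u = 0)
    (by decide) hn (fun s' h => by rw [NExpr.eval_var, h.nat 0 (by decide)])
    (by simp [State.setNat_nat]) ?_ (fun s' _ h => h)
  intro v s₁ hv hfr₁ hv₁ hI
  refine does_for (m := s.nat 0 0 0) (fun i s' => s'.nat 6 0 0 = 0 ↔ s₁.nat 6 0 0 = 0 ∧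
      ∀ u < i, s.real 1 v v = 0 → s.real 1 v u = 0)
    (by decide) hn
    (fun s' h => by rw [NExpr.eval_var, h.nat 0 (by decide), hfr₁.nat 0 (by decide)])
    (by simp [State.setNat_nat]) ?_ ?_
  · intro u s₂ hu hfr₂ hu₂ hI₂
    have hv₂ : s₂.nat 22 0 0 = v := by rw [hfr₂.nat 22 (by decide), hv₁]
    have hr : s₂.real 1 = s.real 1 := by rw [hfr₂.real 1 (by decide), hfr₁.real 1 (by decide)]
    refine does_when (fun h => does_setNat ?_) (fun h => ?_) <;>
    simp only [Test.holds, RExpr.eval, NExpr.eval_var, hv₂, hu₂, hr] at h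
    · simp only [State.setNat_nat, NExpr.eval]
      simp only [Nat.reduceEqDiff, false_and, if_false, and_self, if_true, one_ne_zero, false_iff,
        not_and]
      exact fun _ h' => h.2 (h' u (Nat.lt_succ_self u) h.1)
    · simp only [State.setNat_nat, Nat.reduceEqDiff, false_and, if_false, hI₂]
      refine and_congr_right fun _ => ⟨fun h' w hw h0 => ?_,
        fun h' w hw => h' w (hw.trans_le (Nat.le_succ u))⟩
      rcases Nat.lt_succ_iff_lt_or_eq.1 hw with hw' | rfl
      · exact h' w hw' h0
      · exact by_contra fun h'' => h ⟨h0, h''⟩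
  · intro s' _ h
    simp only [State.setNat_nat, Nat.reduceEqDiff, false_and, if_false, h, hI, and_assoc]
    refine and_congr_right fun _ => ⟨fun h' w hw => ?_,
      fun h' => ⟨fun w hw => h' w (hw.trans_le (Nat.le_succ v)), h' v (Nat.lt_succ_self v)⟩⟩
    rcases Nat.lt_succ_iff_lt_or_eq.1 hw with hw' | rfl
    · exact h'.1 w hw'
    · exact h'.2

/-- Keep the base point and the pivots. -/
def markPivots : Prog :=
  -- The negated conjunction expresses a disjunction: base point or nonzero pivot. The base point
  -- has to be kept separately, as its Gram row is zero.
  .for 22 (.var 0) (.when (.and (inBoth (.var 22)) (.not (.and (.not (.natEq (.var 22) (.var 8)))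
      (.realEq (.get 1 (.var 22) (.var 22)) .zero))))
    (.setNat 7 (.var 22) (.const 0) (.const 1)))

theorem does_markPivots {x : ℕ} {s : State} (hn : s.nat 0 0 0 ≤ x) :
    Does x markPivots s fun s' => ∀ w, s'.nat 7 w 0 = 1 ↔ s.nat 7 w 0 = 1 ∨
      (w < s.nat 0 0 0 ∧ w ∈ cliqueInter s ∧ (w = s.nat 8 0 0 ∨ s.real 1 w w ≠ 0)) := by
  refine does_for (fun i s' => ∀ w, s'.nat 7 w 0 = 1 ↔ s.nat 7 w 0 = 1 ∨
      (w < i ∧ w ∈ cliqueInter s ∧ (w = s.nat 8 0 0 ∨ s.real 1 w w ≠ 0)))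
    (by decide) hn (fun s' h => by rw [NExpr.eval_var, h.nat 0 (by decide)])
    (by simp [State.setNat_nat]) ?_ (fun s' _ h => h)
  intro v s₁ hv hfr hv₁ hI
  have hS := cliqueInter_congr hfr (by decide) (by decide) (by decide)
  have h8 : s₁.nat 8 = s.nat 8 := hfr.nat 8 (by decide)
  have hr : s₁.real 1 = s.real 1 := hfr.real 1 (by decide)
  refine does_when (fun h => does_setNat ?_) (fun h => ?_) <;>
  simp only [Test.holds, holds_inBoth, RExpr.eval, NExpr.eval_var, hv₁, h8, hr, hS] at h <;>
  intro w <;>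
  simp only [State.setNat_nat, NExpr.eval, NExpr.eval_var, Nat.reduceEqDiff, false_and, if_false,
    true_and, and_true, hv₁] <;>
  rcases eq_or_ne w v with rfl | hwv
  · have : w = s.nat 8 0 0 ∨ s.real 1 w w ≠ 0 := by tauto
    simp [h.1, this]
  · have : w < v + 1 ↔ w < v := by omega
    simp [hwv, hI, this]
  · have : ¬ (w ∈ cliqueInter s ∧ (w = s.nat 8 0 0 ∨ s.real 1 w w ≠ 0)) := by tauto
    simp [hI, this]
  · have : w < v + 1 ↔ w < v := by omega
    simp [hI, this]

/-- Count the pivots. -/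
def countPivots : Prog :=
  .seq (.setNat 9 (.const 0) (.const 0) (.const 0))
    (.for 22 (.var 0) (.when (.not (.realEq (.get 1 (.var 22) (.var 22)) .zero))
      (.setNat 9 (.const 0) (.const 0) (.add (.var 9) (.const 1)))))

theorem does_countPivots {x : ℕ} {s : State} (hn : s.nat 0 0 0 ≤ x) :
    Does x countPivots s fun s' =>
      s'.nat 9 0 0 = ((Finset.range (s.nat 0 0 0)).filter fun v => s.real 1 v v ≠ 0).card := by
  refine does_seq (does_setNat ?_)
  refine does_for (m := s.nat 0 0 0)
    (fun i s' => s'.nat 9 0 0 = ((Finset.range i).filter fun v => s.real 1 v v ≠ 0).card)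
    (by decide) hn ?_ ?_ ?_ (fun s' _ h => h)
  · intro s' h
    rw [NExpr.eval_var, h.nat 0 (by decide), State.setNat_nat_of_ne _ (by decide)]
  · simp [State.setNat_nat, NExpr.eval]
  intro v s₁ hv hfr hv₁ hI
  have hr : s₁.real 1 = s.real 1 := hfr.real 1 (by decide)
  rw [Finset.range_add_one, Finset.filter_insert]
  refine does_when (fun h => does_setNat ?_) (fun h => ?_) <;>
  simp only [Test.holds, RExpr.eval, NExpr.eval_var, hv₁, hr] at h
  · rw [if_pos h, Finset.card_insert_of_notMem (by simp)]
    simp [State.setNat_nat, NExpr.eval, hI]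
  · rw [if_neg h]
    simp [State.setNat_nat, hI]

/-- Acceptance: the two tests made by the machine suffice for a determining set of at most `d`
pivots and the base point. Pivots are counted over all indices below `n`, which is harmless because
the rows outside `S` are zero. -/
theorem exists_determines_of_rows {D : ℕ → ℕ → ℝ} {S : Set ℕ} {b n d : ℕ} (hSn : ∀ v ∈ S, v < n)
    (hb : ∀ v ∈ S, b ∈ S) (hdiag : ∀ v ∈ S, D v v = 0) (hsymm : ∀ u ∈ S, ∀ v ∈ S, D u v = D v u)
    (hrow : ∀ v < n, ∀ u < n, elimRow (gram D S b) v v = 0 → elimRow (gram D S b) v u = 0)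
    (hcard : ((Finset.range n).filter fun v => elimRow (gram D S b) v v ≠ 0).card ≤ d) :
    ∃ B : Finset ℕ, B.card ≤ d + 1 ∧
      (∀ w, w ∈ B ↔ w < n ∧ w ∈ S ∧ (w = b ∨ elimRow (gram D S b) w w ≠ 0)) ∧
      Determines (EuclideanSpace ℝ (Fin d)) D B S := by
  rcases S.eq_empty_or_nonempty with rfl | ⟨v₀, hv₀⟩
  · exact ⟨∅, by simp, by simp, by simpa using determines_empty D⟩
  · have hbS := hb v₀ hv₀
    set P := (Finset.range n).filter fun v => elimRow (gram D S b) v v ≠ 0 with hP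
    have hPmem : ∀ v, v ∈ P ↔ v ∈ S ∧ elimRow (gram D S b) v v ≠ 0 := by
      intro v
      simp only [hP, Finset.mem_filter, Finset.mem_range]
      refine ⟨fun h => ⟨?_, h.2⟩, fun h => ⟨hSn v h.1, h.2⟩⟩
      by_contra hv
      exact h.2 (elimRow_gram_of_notMem_right hv v)
    refine ⟨insert b P, (Finset.card_insert_le _ _).trans (by omega), fun w => ?_, ?_⟩
    · rw [Finset.mem_insert, hPmem]
      constructor
      · rintro (rfl | h)
        · exact ⟨hSn _ hbS, hbS, Or.inl rfl⟩
        · exact ⟨hSn _ h.1, h.1, Or.inr h.2⟩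
      · rintro ⟨_, h, rfl | h'⟩
        · exact Or.inl rfl
        · exact Or.inr ⟨h, h'⟩
    · rw [Finset.coe_insert]
      exact determines_pivots hbS hPmem hdiag hsymm fun v hv u hu => hrow v (hSn v hv) u (hSn u hu)

/-- Soundness of rejection: a realizable intersection passes both tests, by the comparison with
Gram–Schmidt. -/
theorem Realizes.rows_and_card_le {D : ℕ → ℕ → ℝ} {S : Set ℕ} {b n d : ℕ}
    (hb : ∀ v ∈ S, b ∈ S) {p : ℕ → EuclideanSpace ℝ (Fin d)} (hp : Realizes D S p) :
    (∀ v < n, ∀ u < n, elimRow (gram D S b) v v = 0 → elimRow (gram D S b) v u = 0) ∧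
      ((Finset.range n).filter fun v => elimRow (gram D S b) v v ≠ 0).card ≤ d := by
  rcases S.eq_empty_or_nonempty with rfl | ⟨v₀, hv₀⟩
  · have h : ∀ v u, elimRow (gram D ∅ b) v u = 0 := fun v u =>
      elimRow_gram_of_notMem_right (Set.notMem_empty u) v
    simp [h]
  · refine ⟨fun v _ u _ h => hp.elimRow_eq_zero (hb v₀ hv₀) h u, ?_⟩
    simpa using hp.card_pivots_le (hb v₀ hv₀) (P := (Finset.range n).filter fun v =>
      elimRow (gram D S b) v v ≠ 0) (fun v hv => (Finset.mem_filter.1 hv).2)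

/-- Treat the intersection of the two cliques with the current indices. -/
def processPair : Prog :=
  .seq chooseBase (.seq eliminate (.seq checkRows (.seq markPivots (.seq countPivots
    (.when (.natLT (.var 1) (.var 9)) (.setNat 6 (.const 0) (.const 0) (.const 1)))))))

/-- The two conclusions are not complementary: an intersection without realization may be accepted,
since a determining set is all that gluing needs. -/
theorem does_processPair {x : ℕ} {s : State} (hn : s.nat 0 0 0 ≤ x)
    (hSn : ∀ v ∈ cliqueInter s, v < s.nat 0 0 0) (hdiag : ∀ v ∈ cliqueInter s, s.real 0 v v = 0)
    (hsymm : ∀ u ∈ cliqueInter s, ∀ v ∈ cliqueInter s, s.real 0 u v = s.real 0 v u) :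
    Does x processPair s fun s' =>
      (s'.nat 6 0 0 = 0 → s.nat 6 0 0 = 0 ∧ ∃ B : Finset ℕ, B.card ≤ s.nat 1 0 0 + 1 ∧
        (∀ w, s'.nat 7 w 0 = 1 ↔ s.nat 7 w 0 = 1 ∨ w ∈ B) ∧
        Determines (EuclideanSpace ℝ (Fin (s.nat 1 0 0))) (s.real 0) B (cliqueInter s)) ∧
      (s'.nat 6 0 0 ≠ 0 → s.nat 6 0 0 ≠ 0 ∨
        ¬ ∃ p : ℕ → EuclideanSpace ℝ (Fin (s.nat 1 0 0)), Realizes (s.real 0) (cliqueInter s) p) := by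
  set n := s.nat 0 0 0 with hn_def
  set d := s.nat 1 0 0 with hd_def
  set S := cliqueInter s with hS
  set D := s.real 0 with hD
  refine does_seq ((does_chooseBase hn).imp fun s₁ hb f₁ => ?_)
  have hn₁ : s₁.nat 0 0 0 = n := by rw [f₁.nat 0 (by decide)]
  have hS₁ : cliqueInter s₁ = S := cliqueInter_congr f₁ (by decide) (by decide) (by decide)
  have hD₁ : s₁.real 0 = D := f₁.real 0 (by decide)
  set b := s₁.nat 8 0 0 with hb_def
  have hb' : ∀ v ∈ S, b ∈ S := fun v hv => hb v (hSn v hv) hv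
  have hg₁ : curGram s₁ = gram D S b := by rw [curGram, hS₁, hD₁]
  refine does_seq ((does_eliminate (hn₁.le.trans hn)).imp fun s₂ hL f₂ => ?_)
  rw [hn₁, hg₁] at hL
  have hn₂ : s₂.nat 0 0 0 = n := by rw [f₂.nat 0 (by decide), hn₁]
  have hS₂ : cliqueInter s₂ = S :=
    (cliqueInter_congr f₂ (by decide) (by decide) (by decide)).trans hS₁
  refine does_seq ((does_checkRows (hn₂.le.trans hn)).imp fun s₃ h6 f₃ => ?_)
  rw [hn₂, f₂.nat 6 (by decide), f₁.nat 6 (by decide)] at h6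
  have hn₃ : s₃.nat 0 0 0 = n := by rw [f₃.nat 0 (by decide), hn₂]
  have hS₃ : cliqueInter s₃ = S :=
    (cliqueInter_congr f₃ (by decide) (by decide) (by decide)).trans hS₂
  have hb₃ : s₃.nat 8 0 0 = b := by rw [f₃.nat 8 (by decide), f₂.nat 8 (by decide)]
  have hL₃ : s₃.real 1 = s₂.real 1 := f₃.real 1 (by decide)
  refine does_seq ((does_markPivots (hn₃.le.trans hn)).imp fun s₄ h7 f₄ => ?_)
  rw [hn₃, hS₃, hb₃, hL₃, f₃.nat 7 (by decide), f₂.nat 7 (by decide), f₁.nat 7 (by decide)] at h7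
  have hn₄ : s₄.nat 0 0 0 = n := by rw [f₄.nat 0 (by decide), hn₃]
  have hL₄ : s₄.real 1 = s₂.real 1 := by rw [f₄.real 1 (by decide), hL₃]
  refine does_seq ((does_countPivots (hn₄.le.trans hn)).imp fun s₅ h9 f₅ => ?_)
  rw [hn₄, hL₄] at h9
  have hd₅ : s₅.nat 1 0 0 = d := by
    rw [f₅.nat 1 (by decide), f₄.nat 1 (by decide), f₃.nat 1 (by decide), f₂.nat 1 (by decide),
      f₁.nat 1 (by decide)]
  have h6₅ : s₅.nat 6 = s₃.nat 6 := by rw [f₅.nat 6 (by decide), f₄.nat 6 (by decide)]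
  have h7₅ : s₅.nat 7 = s₄.nat 7 := f₅.nat 7 (by decide)
  have h9' : s₅.nat 9 0 0 =
      ((Finset.range n).filter fun v => elimRow (gram D S b) v v ≠ 0).card := by
    rw [h9]
    congr 1
    refine Finset.filter_congr fun v hv => ?_
    rw [hL v (Finset.mem_range.1 hv) v (Finset.mem_range.1 hv)]
  have h6' : s₅.nat 6 0 0 = 0 ↔ s.nat 6 0 0 = 0 ∧ ∀ v < n, ∀ u < n,
      elimRow (gram D S b) v v = 0 → elimRow (gram D S b) v u = 0 := by
    rw [h6₅, h6]
    refine and_congr_right fun _ => ?_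
    refine forall₂_congr fun v hv => forall₂_congr fun u hu => ?_
    rw [hL v hv v hv, hL v hv u hu]
  refine does_when (fun h => does_setNat ?_) (fun h => ?_) <;>
    simp only [Test.holds, NExpr.eval_var, hd₅, h9'] at h
  · refine ⟨fun h0 => by simp [State.setNat_nat, NExpr.eval] at h0, fun _ => Or.inr ?_⟩
    rintro ⟨p, hp⟩
    exact absurd (hp.rows_and_card_le hb').2 (not_le.2 h)
  · refine ⟨fun h0 => ?_, fun h0 => ?_⟩
    · obtain ⟨h1, h2⟩ := h6'.1 h0
      obtain ⟨B, hB, hmem, hdet⟩ :=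
        exists_determines_of_rows hSn hb' hdiag hsymm h2 (not_lt.1 h)
      refine ⟨h1, B, hB, fun w => ?_, hdet⟩
      rw [h7₅, h7, hmem]
      refine or_congr_right (and_congr_right fun hw => ?_)
      rw [hL w hw w hw]
    · by_contra! hcon
      obtain ⟨h1, p, hp⟩ := hcon
      exact h0 (h6'.2 ⟨h1, (hp.rows_and_card_le hb').1⟩)

/-- The `i`-th set of a family given by an incidence matrix. -/
def cliqueSet (c : ℕ → ℕ → ℕ) (i : ℕ) : Set ℕ := {v | c i v = 1}

/-- Either the kept vertices are obtained from sets which determine the intersections of the cliques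
whose pairs of indices are in `T`, or there is a clique intersection without a realization. -/
def PairsInv (d k : ℕ) (D : ℕ → ℕ → ℝ) (c : ℕ → ℕ → ℕ) (T : Finset (ℕ × ℕ)) (s : State) : Prop :=
  (s.nat 6 0 0 = 0 → ∃ B : ℕ × ℕ → Finset ℕ,
    (∀ q ∈ T, (B q).card ≤ d + 1 ∧
      Determines (EuclideanSpace ℝ (Fin d)) D (B q) (cliqueSet c q.1 ∩ cliqueSet c q.2)) ∧
    ∀ w, s.nat 7 w 0 = 1 ↔ w ∈ T.biUnion B) ∧
  (s.nat 6 0 0 ≠ 0 → ∃ i < k, ∃ j < k,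
    ¬ ∃ p : ℕ → EuclideanSpace ℝ (Fin d), Realizes D (cliqueSet c i ∩ cliqueSet c j) p)

theorem PairsInv.congr {d k : ℕ} {D : ℕ → ℕ → ℝ} {c : ℕ → ℕ → ℕ} {T T' : Finset (ℕ × ℕ)}
    {s s' : State} (h : PairsInv d k D c T s) (hT : T' = T) (h6 : s'.nat 6 = s.nat 6)
    (h7 : s'.nat 7 = s.nat 7) : PairsInv d k D c T' s' := by
  subst hT
  rwa [PairsInv, h6, h7]

/-- Treat all pairs of cliques. -/
def processPairs : Prog := .for 20 (.var 2) (.for 21 (.var 2) processPair)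

theorem does_processPairs {x : ℕ} {s : State} (hn : s.nat 0 0 0 ≤ x) (hk : s.nat 2 0 0 ≤ x)
    (hSn : ∀ i, ∀ v ∈ cliqueSet (s.nat 4) i, v < s.nat 0 0 0)
    (hdiag : ∀ v, s.real 0 v v = 0) (hsymm : ∀ u v, s.real 0 u v = s.real 0 v u)
    (h6 : s.nat 6 0 0 = 0) (h7 : ∀ w, s.nat 7 w 0 = 0) :
    Does x processPairs s (PairsInv (s.nat 1 0 0) (s.nat 2 0 0) (s.real 0) (s.nat 4)
      (Finset.range (s.nat 2 0 0) ×ˢ Finset.range (s.nat 2 0 0))) := by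
  set k := s.nat 2 0 0 with hk_def
  refine does_for (m := k)
    (fun i => PairsInv (s.nat 1 0 0) k (s.real 0) (s.nat 4) (Finset.range i ×ˢ Finset.range k))
    (by decide) hk (fun s' h => by rw [NExpr.eval_var, h.nat 2 (by decide)])
    ⟨fun _ => ⟨fun _ => ∅, by simp, by simp [State.setNat_nat, h7]⟩,
      fun h => (h (by simp [State.setNat_nat, h6])).elim⟩ ?_ (fun s' _ h => h)
  intro i s₁ hi f₁ hi₁ hI
  -- The pairs treated so far are the complete rows before `i` and the first `j` pairs of row `i`.
  refine does_for (m := k) (fun j => PairsInv (s.nat 1 0 0) k (s.real 0) (s.nat 4)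
      (Finset.range i ×ˢ Finset.range k ∪ {i} ×ˢ Finset.range j))
    (by decide) hk
    (fun s' h => by rw [NExpr.eval_var, h.nat 2 (by decide), f₁.nat 2 (by decide)])
    (hI.congr (by simp) (State.setNat_nat_of_ne _ (by decide) _ _ _)
      (State.setNat_nat_of_ne _ (by decide) _ _ _)) ?_ ?_
  · intro j s₂ hj f₂ hj₂ hI₂
    have hi₂ : s₂.nat 20 0 0 = i := by rw [f₂.nat 20 (by decide), hi₁]
    have hn₂ : s₂.nat 0 = s.nat 0 := by rw [f₂.nat 0 (by decide), f₁.nat 0 (by decide)]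
    have hd₂ : s₂.nat 1 = s.nat 1 := by rw [f₂.nat 1 (by decide), f₁.nat 1 (by decide)]
    have hD₂ : s₂.real 0 = s.real 0 := by rw [f₂.real 0 (by decide), f₁.real 0 (by decide)]
    have hc₂ : s₂.nat 4 = s.nat 4 := by rw [f₂.nat 4 (by decide), f₁.nat 4 (by decide)]
    have hS₂ : cliqueInter s₂ = cliqueSet (s.nat 4) i ∩ cliqueSet (s.nat 4) j := by
      ext v
      simp [cliqueInter, cliqueSet, hi₂, hj₂, hc₂]
    refine (does_processPair (by rwa [hn₂]) ?_ (by simp [hD₂, hdiag])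
      (fun u _ v _ => by rw [hD₂, hsymm])).imp ?_
    · intro v hv
      rw [hS₂] at hv
      rw [hn₂]
      exact hSn i v hv.1
    · rintro s₃ ⟨h, h'⟩ _
      rw [hd₂, hD₂, hS₂] at h h'
      refine PairsInv.congr (s := s₃) (T := insert (i, j)
        (Finset.range i ×ˢ Finset.range k ∪ {i} ×ˢ Finset.range j)) ⟨?_, ?_⟩ ?_
        (State.setNat_nat_of_ne _ (by decide) _ _ _) (State.setNat_nat_of_ne _ (by decide) _ _ _)
      · intro h0
        obtain ⟨h1, B', hB', h7', hdet⟩ := h h0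
        obtain ⟨B, hB, h7⟩ := hI₂.1 h1
        have hnot : (i, j) ∉ Finset.range i ×ˢ Finset.range k ∪ {i} ×ˢ Finset.range j := by simp
        have hupd : ∀ q ∈ Finset.range i ×ˢ Finset.range k ∪ {i} ×ˢ Finset.range j,
            Function.update B (i, j) B' q = B q := by
          intro q hq
          rw [Function.update_of_ne]
          rintro rfl
          exact hnot hq
        refine ⟨Function.update B (i, j) B', ?_, fun w => ?_⟩
        · intro q hq
          rcases Finset.mem_insert.1 hq with rfl | hq
          · rw [Function.update_self]
            exact ⟨hB', hdet⟩
          · rw [hupd q hq]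
            exact hB q hq
        · rw [h7', h7, Finset.biUnion_insert, Function.update_self, Finset.mem_union, or_comm,
            Finset.biUnion_congr rfl hupd]
      · intro h0
        rcases h' h0 with h1 | h1
        · exact hI₂.2 h1
        · exact ⟨i, hi, j, hj, h1⟩
      · ext ⟨a, b⟩
        simp only [Finset.mem_union, Finset.mem_product, Finset.mem_range, Finset.mem_singleton,
          Finset.mem_insert, Prod.mk.injEq]
        omega
  · intro s' _ h
    refine h.congr ?_ (State.setNat_nat_of_ne _ (by decide) _ _ _)
      (State.setNat_nat_of_ne _ (by decide) _ _ _)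
    ext ⟨a, b⟩
    simp only [Finset.mem_union, Finset.mem_product, Finset.mem_range, Finset.mem_singleton]
    omega

/-- List the kept vertices in increasing order. -/
def listKept : Prog :=
  .seq (.setNat 10 (.const 0) (.const 0) (.const 0))
    (.for 22 (.var 0) (.when (.natEq (.get 7 (.var 22) (.const 0)) (.const 1))
      (.seq (.setNat 11 (.var 10) (.const 0) (.var 22))
        (.setNat 10 (.const 0) (.const 0) (.add (.var 10) (.const 1))))))

theorem does_listKept {x : ℕ} {s : State} (hn : s.nat 0 0 0 ≤ x) :
    Does x listKept s fun s' =>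
      s'.nat 10 0 0 = Nat.count (fun w => s.nat 7 w 0 = 1) (s.nat 0 0 0) ∧
      ∀ j < s'.nat 10 0 0, s'.nat 11 j 0 = Nat.nth (fun w => s.nat 7 w 0 = 1) j := by
  set p : ℕ → Prop := fun w => s.nat 7 w 0 = 1 with hp
  refine does_seq (does_setNat ?_)
  refine does_for (m := s.nat 0 0 0) (fun i s' => s'.nat 10 0 0 = Nat.count p i ∧
      ∀ j < s'.nat 10 0 0, s'.nat 11 j 0 = Nat.nth p j)
    (by decide) hn ?_ ?_ ?_ (fun s' _ h => h)
  · intro s' h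
    rw [NExpr.eval_var, h.nat 0 (by decide), State.setNat_nat_of_ne _ (by decide)]
  · simp [State.setNat_nat, NExpr.eval]
  rintro v s₁ hv f₁ hv₁ ⟨hI₁, hI₂⟩
  have h7 : s₁.nat 7 = s.nat 7 := by
    rw [f₁.nat 7 (by decide), State.setNat_nat_of_ne _ (by decide)]
  refine does_when (fun h => does_seq (does_setNat (does_setNat ?_))) (fun h => ?_) <;>
    simp only [Test.holds, NExpr.eval, NExpr.eval_var, hv₁, h7] at h
  · have hpv : p v := h
    simp only [State.setNat_nat, NExpr.eval, NExpr.eval_var, Nat.reduceEqDiff, false_and, if_false,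
      and_self, if_true, true_and, and_true, hv₁, hI₁]
    refine ⟨by rw [Nat.count_succ, if_pos hpv], fun j hj => ?_⟩
    split_ifs with hjc
    · rw [hjc, Nat.nth_count hpv]
    · exact hI₂ j (by omega)
  · have hpv : ¬ p v := h
    simp only [State.setNat_nat, Nat.reduceEqDiff, false_and, if_false]
    exact ⟨by rw [hI₁, Nat.count_succ, if_neg hpv, add_zero], hI₂⟩

/-- Copy parts of the array `a` of natural numbers to `a'` and of the array `r` of real numbers to
`r'`, where the row and column indices of the source are computed by `f`. -/
def copyArrays (a a' r r' : ℕ) (f : NExpr → NExpr) : Prog :=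
  .for 22 (.var 10) (.for 23 (.var 10)
    (.seq (.setNat a' (.var 22) (.var 23) (.get a (f (.var 22)) (f (.var 23))))
      (.setReal r' (.var 22) (.var 23) (.get r (f (.var 22)) (f (.var 23))))))

theorem does_copyArrays {x a a' r r' : ℕ} {f : NExpr → NExpr} {φ : ℕ → ℕ} {s : State}
    (hm : s.nat 10 0 0 ≤ x) (ha : a ≠ a' ∧ a ≠ 22 ∧ a ≠ 23) (ha' : a' ≠ 10 ∧ a' ≠ 22 ∧ a' ≠ 23)
    (hr : r ≠ r')
    (hf : ∀ e s', Frame (copyArrays a a' r r' f) s s' → (f e).eval s' = φ (e.eval s')) :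
    Does x (copyArrays a a' r r' f) s fun s' => ∀ i < s.nat 10 0 0, ∀ j < s.nat 10 0 0,
      s'.nat a' i j = s.nat a (φ i) (φ j) ∧ s'.real r' i j = s.real r (φ i) (φ j) := by
  obtain ⟨ha1, ha2, ha3⟩ := ha
  obtain ⟨hb1, hb2, hb3⟩ := ha'
  refine does_for (m := s.nat 10 0 0) (fun v s' => ∀ i < v, ∀ j < s.nat 10 0 0,
      s'.nat a' i j = s.nat a (φ i) (φ j) ∧ s'.real r' i j = s.real r (φ i) (φ j))
    (by simp [Prog.for, Prog.natWrites, hb2.symm]) hm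
    (fun s' h => by
      rw [NExpr.eval_var, h.nat 10 (by simp [Prog.for, Prog.natWrites, hb1.symm])]) (by simp) ?_
    (fun s' _ h => h)
  intro v s₁ hv f₁ hv₁ hI
  refine does_for (m := s.nat 10 0 0) (fun u s' => (∀ i < v, ∀ j < s.nat 10 0 0,
      s'.nat a' i j = s.nat a (φ i) (φ j) ∧ s'.real r' i j = s.real r (φ i) (φ j)) ∧
      ∀ j < u, s'.nat a' v j = s.nat a (φ v) (φ j) ∧ s'.real r' v j = s.real r (φ v) (φ j))
    (by simp [Prog.natWrites, hb3.symm]) hm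
    (fun s' h => by
      rw [NExpr.eval_var, h.nat 10 (by simp [Prog.for, Prog.natWrites, hb1.symm]),
        f₁.nat 10 (by simp [Prog.for, Prog.natWrites, hb1.symm])])
    ⟨by simpa [State.setNat_nat, hb3] using hI, by simp⟩ ?_ ?_
  · rintro u s₂ hu f₂ hu₂ ⟨hI₁, hI₂⟩
    have f₁₂ : Frame (copyArrays a a' r r' f) s s₂ :=
      f₁.trans (f₂.mono (by simp [Prog.for, Prog.natWrites]) (by simp [Prog.for, Prog.realWrites]))
    have hv₂ : s₂.nat 22 0 0 = v := by
      rw [f₂.nat 22 (by simp [Prog.for, Prog.natWrites, hb2.symm]), hv₁]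
    have ha₂ : s₂.nat a = s.nat a :=
      f₁₂.nat a (by simp [copyArrays, Prog.for, Prog.natWrites, ha1, ha2, ha3])
    have hr₂ : s₂.real r = s.real r :=
      f₁₂.real r (by simp [copyArrays, Prog.for, Prog.realWrites, hr])
    refine does_seq (does_setNat (does_setReal ?_))
    -- The indices of the real copy are evaluated after the natural number has been written, so `f`
    -- must still compute `φ` there.
    have f₁₃ := f₁₂.trans (s₃ := s₂.setNat a' (NExpr.eval s₂ (.var 22)) (NExpr.eval s₂ (.var 23))
        (NExpr.eval s₂ (.get a (f (.var 22)) (f (.var 23)))))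
      ⟨fun b hb => State.setNat_nat_of_ne _ (fun h => hb (by
        simp [copyArrays, Prog.for, Prog.natWrites, h])) _ _ _, fun _ _ => rfl⟩
    simp only [NExpr.eval, RExpr.eval, NExpr.eval_var, hf _ _ f₁₂, hv₂, hu₂, ha₂] at f₁₃ ⊢
    simp only [hf _ _ f₁₃, NExpr.eval_var, State.setReal_nat, State.setNat_real, State.setReal_real,
      State.setNat_nat, hb2.symm, hb3.symm, hb3, false_and, if_false, hv₂, hu₂, hr₂, true_and]
    refine ⟨fun i hi j hj => ?_, fun j hj => ?_⟩
    · simpa [hi.ne] using hI₁ i hi j hj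
    · rcases Nat.lt_succ_iff_lt_or_eq.1 hj with hj' | rfl
      · simpa [hj'.ne] using hI₂ j hj'
      · simp
  · rintro s' _ ⟨h₁, h₂⟩ i hi j hj
    rw [State.setNat_real, State.setNat_nat_of_ne _ hb2]
    rcases Nat.lt_succ_iff_lt_or_eq.1 hi with hi' | rfl
    · exact h₁ i hi' j hj
    · exact h₂ j hj

/-- Replace the instance by its restriction to the kept vertices. -/
def restrictToKept : Prog :=
  -- Copying through auxiliary arrays ensures that no source cell is overwritten before it is read.
  .seq (copyArrays 3 12 0 2 fun e => .get 11 e (.const 0)) (.seq (copyArrays 12 3 2 0 id)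
    (.seq (.setNat 0 (.const 0) (.const 0) (.var 10))
      (.setNat 5 (.const 0) (.const 0) (.const 2))))

theorem does_restrictToKept {x : ℕ} {s : State} (hm : s.nat 10 0 0 ≤ x) :
    Does x restrictToKept s fun s' => s'.nat 5 0 0 = 2 ∧ s'.nat 0 0 0 = s.nat 10 0 0 ∧
      s'.nat 1 0 0 = s.nat 1 0 0 ∧ ∀ i < s.nat 10 0 0, ∀ j < s.nat 10 0 0,
        s'.nat 3 i j = s.nat 3 (s.nat 11 i 0) (s.nat 11 j 0) ∧
        s'.real 0 i j = s.real 0 (s.nat 11 i 0) (s.nat 11 j 0) := by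
  refine does_seq ((does_copyArrays (φ := fun i => s.nat 11 i 0) hm (by decide) (by decide)
    (by decide) ?_).imp fun s₁ h₁ f₁ => ?_)
  · intro e s' h
    simp [NExpr.eval, h.nat 11 (by decide)]
  have hm₁ : s₁.nat 10 = s.nat 10 := f₁.nat 10 (by decide)
  refine does_seq ((does_copyArrays (φ := id) (by rwa [hm₁]) (by decide) (by decide) (by decide)
    (fun _ _ _ => rfl)).imp fun s₂ h₂ f₂ => ?_)
  have hm₂ : s₂.nat 10 = s.nat 10 := (f₂.nat 10 (by decide)).trans hm₁
  have hd₂ : s₂.nat 1 = s.nat 1 := (f₂.nat 1 (by decide)).trans (f₁.nat 1 (by decide))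
  refine does_seq (does_setNat (does_setNat ⟨?_, ?_, ?_, fun i hi j hj => ?_⟩))
  · simp [State.setNat_nat, NExpr.eval]
  · simp [State.setNat_nat, NExpr.eval, hm₂]
  · simp [State.setNat_nat, hd₂]
  · rw [hm₁] at h₂
    have h3 := h₁ i hi j hj
    have h4 := h₂ i hi j hj
    simp only [id] at h4
    rw [← h4.1, ← h4.2] at h3
    simpa [State.setNat_nat] using h3

/-! ### Partial matrices and their encoding in memory -/

theorem isYes_iff {n : ℕ} {M : PartialMatrix n} {d : ℕ} : IsYes M d ↔
    ∃ p : Fin n → EuclideanSpace ℝ (Fin d), ∀ i j r, M i j = some r → ‖p i - p j‖ ^ 2 = r := by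
  constructor
  · rintro ⟨D, ⟨p, hp⟩, hD⟩
    exact ⟨p, fun i j r h => by rw [← hp, hD i j r h]⟩
  · rintro ⟨p, hp⟩
    exact ⟨fun i j => ‖p i - p j‖ ^ 2, ⟨p, fun _ _ => rfl⟩, hp⟩

theorem IsYes.submatrix {n m d : ℕ} {M : PartialMatrix n} (h : IsYes M d) (e : Fin m → Fin n) :
    IsYes (M.submatrix e e) d := by
  obtain ⟨p, hp⟩ := isYes_iff.1 h
  exact isYes_iff.2 ⟨p ∘ e, fun i j r h => hp _ _ r h⟩

section Input

variable {n k d : ℕ} {G : SimpleGraph (Fin n)} {M : PartialMatrix n} {C : Fin k → Finset (Fin n)}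

theorem inputState_real (i j : Fin n) :
    (inputState M d C).real 0 i j = (M i j).getD 0 := by
  simp [inputState, tabulate]

theorem inputState_pattern (i j : Fin n) :
    (inputState M d C).nat 3 i j = pattern M i j := by
  simp [inputState, tabulate]

theorem inputState_real_self (hM : IsGPartial G M) (v : ℕ) :
    (inputState M d C).real 0 v v = 0 := by
  simp only [inputState, tabulate]
  split_ifs <;> simp [hM.diag]

theorem inputState_real_symm (hM : IsGPartial G M) (u v : ℕ) :
    (inputState M d C).real 0 u v = (inputState M d C).real 0 v u := by
  simp only [inputState, tabulate]
  by_cases hu : u < n <;> by_cases hv : v < n <;> simp [hu, hv]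
  rw [hM.symm]

theorem mem_cliqueSet_inputState {i v : ℕ} :
    v ∈ cliqueSet ((inputState M d C).nat 4) i ↔
      ∃ (hi : i < k) (hv : v < n), (⟨v, hv⟩ : Fin n) ∈ C ⟨i, hi⟩ := by
  simp only [cliqueSet, Set.mem_ofPred_eq, inputState, tabulate]
  by_cases hi : i < k <;> by_cases hv : v < n <;> simp [hi, hv]

/-- The default 0 that stands for unspecified entries in memory is therefore never mistaken for a
distance inside a clique. -/
theorem eq_some_of_mem_clique (hM : IsGPartial G M) (hC : IsEdgeCliqueCover G C) {i : Fin k}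
    {u v : Fin n} (hu : u ∈ C i) (hv : v ∈ C i) : M u v = some ((M u v).getD 0) := by
  have : (M u v).isSome := by
    rcases eq_or_ne u v with rfl | huv
    · simp [hM.diag]
    · exact (hM.specified_iff u v huv).2 (hC.isClique i hu hv huv)
  obtain ⟨r, hr⟩ := Option.isSome_iff_exists.1 this
  simp [hr]

/-- A realization of a principal submatrix realizes the kept part of each clique. -/
theorem IsYes.exists_realizes (hM : IsGPartial G M) (hC : IsEdgeCliqueCover G C) {m : ℕ}
    (e : Fin m ↪ Fin n) (h : IsYes (M.submatrix e e) d) :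
    ∃ p : ℕ → EuclideanSpace ℝ (Fin d), ∀ i, Realizes ((inputState M d C).real 0)
      (Set.range (fun j => (e j : ℕ)) ∩ cliqueSet ((inputState M d C).nat 4) i) p := by
  obtain ⟨p, hp⟩ := isYes_iff.1 h
  have hinj : Function.Injective fun j => (e j : ℕ) := fun a b hab => e.injective (Fin.ext hab)
  refine ⟨Function.extend (fun j => (e j : ℕ)) p 0, fun i => ?_⟩
  rintro _ ⟨⟨a, rfl⟩, ha⟩ _ ⟨⟨b, rfl⟩, hb⟩
  obtain ⟨hi, _, ha⟩ := mem_cliqueSet_inputState.1 ha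
  obtain ⟨_, _, hb⟩ := mem_cliqueSet_inputState.1 hb
  rw [hinj.extend_apply, hinj.extend_apply, inputState_real]
  exact hp a b _ (eq_some_of_mem_clique hM hC ha hb)

theorem isYes_of_realizes (hM : IsGPartial G M) (hC : IsEdgeCliqueCover G C)
    {q : ℕ → EuclideanSpace ℝ (Fin d)} (hq : ∀ i : Fin k, Realizes ((inputState M d C).real 0)
      (cliqueSet ((inputState M d C).nat 4) i) q) : IsYes M d := by
  refine isYes_iff.2 ⟨fun v => q v, fun u v r hr => ?_⟩
  -- The diagonal is separate because an isolated vertex may lie in no clique.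
  rcases eq_or_ne u v with rfl | huv
  · rw [hM.diag] at hr
    simpa using hr
  · obtain ⟨i, hu, hv⟩ := hC.covers u v ((hM.specified_iff u v huv).1 (by simp [hr]))
    rw [hq i u (mem_cliqueSet_inputState.2 ⟨i.2, u.2, hu⟩) v
      (mem_cliqueSet_inputState.2 ⟨i.2, v.2, hv⟩), inputState_real, hr]
    rfl

end Input

/-- The kernelization program. -/
def kernelize : Prog :=
  .seq processPairs (.when (.natEq (.var 6) (.const 0)) (.seq listKept
    (.ite (.natEq (.var 10) (.const 0)) (.setNat 5 (.const 0) (.const 0) (.const 1))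
      restrictToKept)))

theorem does_kernelize {n k d : ℕ} {G : SimpleGraph (Fin n)} {M : PartialMatrix n}
    {C : Fin k → Finset (Fin n)} (hM : IsGPartial G M) (hC : IsEdgeCliqueCover G C) :
    Does (n + k) kernelize (inputState M d C) (IsCorrectOutput M d ((d + 1) * k ^ 2)) := by
  have hn₀ : (inputState M d C).nat 0 0 0 = n := by simp [inputState, scalar]
  have hd₀ : (inputState M d C).nat 1 0 0 = d := by simp [inputState, scalar]
  have hk₀ : (inputState M d C).nat 2 0 0 = k := by simp [inputState, scalar]
  have h5₀ : (inputState M d C).nat 5 0 0 = 0 := by simp [inputState]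
  have hcn : ∀ i, ∀ v ∈ cliqueSet ((inputState M d C).nat 4) i, v < n := by
    intro i v hv
    obtain ⟨_, h, _⟩ := mem_cliqueSet_inputState.1 hv
    exact h
  refine does_seq ((does_processPairs (by omega) (by omega) (by rwa [hn₀])
    (inputState_real_self hM) (inputState_real_symm hM) (by simp [inputState])
    (by simp [inputState])).imp ?_)
  intro s₁ hinv f₁
  rw [hd₀, hk₀] at hinv
  have h5₁ : s₁.nat 5 0 0 = 0 := by rw [f₁.nat 5 (by decide), h5₀]
  refine does_when (fun h6 => ?_) (fun h6 => ?_) <;>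
    simp only [Test.holds, NExpr.eval, NExpr.eval_var] at h6
  · obtain ⟨B, hB, h7⟩ := hinv.1 h6
    set K := (Finset.range k ×ˢ Finset.range k).biUnion B with hK
    have hKn : ∀ w ∈ K, w < n := by
      intro w hw
      obtain ⟨q, hq, hwq⟩ := Finset.mem_biUnion.1 hw
      exact hcn _ w ((hB q hq).2.subset hwq).1
    have hKcard : K.card ≤ (d + 1) * k ^ 2 := by
      refine (Finset.card_biUnion_le_card_mul _ _ (d + 1) fun q hq => (hB q hq).1).trans (le_of_eq ?_)
      simp only [Finset.card_product, Finset.card_range]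
      ring
    have hglue : ∀ p : ℕ → EuclideanSpace ℝ (Fin d),
        (∀ i, Realizes ((inputState M d C).real 0)
          ((K : Set ℕ) ∩ cliqueSet ((inputState M d C).nat 4) i) p) → IsYes M d := by
      intro p hp
      have hT : ∀ i j : Fin k, ((i : ℕ), (j : ℕ)) ∈ Finset.range k ×ˢ Finset.range k := by simp
      obtain ⟨q, hq⟩ := exists_realizes_of_determines (K := (K : Set ℕ))
        (C := fun i : Fin k => cliqueSet ((inputState M d C).nat 4) i)
        (B := fun i j : Fin k => (B (i, j) : Set ℕ))
        (fun i j w hw => Finset.mem_biUnion.2 ⟨_, hT i j, hw⟩)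
        (fun i j => (hB _ (hT i j)).2) (fun i => hp i)
      exact isYes_of_realizes hM hC hq
    have hn₁ : s₁.nat 0 0 0 = n := by rw [f₁.nat 0 (by decide), hn₀]
    refine does_seq ((does_listKept (by omega)).imp ?_)
    rintro s₂ ⟨h10, h11⟩ f₂
    set P : ℕ → Prop := fun w => s₁.nat 7 w 0 = 1 with hP
    rw [hn₁] at h10
    have hmK : s₂.nat 10 0 0 ≤ K.card := by
      rw [h10, Nat.count_eq_card_filter_range]
      exact Finset.card_le_card fun w hw => (h7 w).1 (Finset.mem_filter.1 hw).2
    refine does_ite (fun h0 => does_setNat ?_) (fun h0 => ?_) <;>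
      simp only [Test.holds, NExpr.eval, NExpr.eval_var] at h0
    -- With no kept vertex there is nothing to realize, so gluing applies to any `p`. Answering yes
    -- here avoids an empty output matrix.
    · refine Or.inr (Or.inl ⟨by simp [answer, State.setNat_nat, NExpr.eval], hglue 0 ?_⟩)
      rintro i u ⟨hu, _⟩
      have h1 : Nat.count P u < Nat.count P n := Nat.count_strict_mono ((h7 u).2 hu) (hKn u hu)
      have h2 : Nat.count P n = 0 := h10.symm.trans h0
      omega
    · have hmn : s₂.nat 10 0 0 ≤ n := by rw [h10]; exact Nat.count_le _
      refine (does_restrictToKept (by omega)).imp ?_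
      rintro s₃ ⟨h5, hn₃, hd₃, hmat⟩ _
      have hlt : ∀ j : Fin (s₂.nat 10 0 0), Nat.nth P j < n := fun j =>
        Nat.nth_lt_of_lt_count (j.2.trans_eq h10)
      -- `Nat.nth` takes the default value 0 beyond the end of a finite set, so the indices must be
      -- shown to stay below its cardinality.
      have hcard : ∀ (hf : (Set.ofPred P).Finite) (j : Fin (s₂.nat 10 0 0)),
          (j : ℕ) < hf.toFinset.card := by
        refine fun hf j => j.2.trans_le ?_
        rw [h10, Nat.count_eq_card_filter_range]
        exact Finset.card_le_card fun w hw => hf.mem_toFinset.2 (Finset.mem_filter.1 hw).2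
      have hmono : StrictMono fun j : Fin (s₂.nat 10 0 0) => (⟨Nat.nth P j, hlt j⟩ : Fin n) := by
        intro a b hab
        exact Nat.nth_lt_nth' hab fun hf => hcard hf b
      set e := OrderEmbedding.ofStrictMono _ hmono with he
      have hev : ∀ j, ((e j : Fin n) : ℕ) = s₂.nat 11 j 0 := fun j => (h11 j j.2).symm
      have hrange : Set.range (fun j => ((e j : Fin n) : ℕ)) = (K : Set ℕ) := by
        ext w
        constructor
        · rintro ⟨j, rfl⟩
          refine (h7 _).1 (Nat.nth_mem (p := P) j fun hf => hcard hf j)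
        · intro hw
          have hPw : P w := (h7 w).2 hw
          exact ⟨⟨Nat.count P w, (Nat.count_strict_mono hPw (hKn w hw)).trans_eq h10.symm⟩,
            Nat.nth_count hPw⟩
      have h3 : s₂.nat 3 = (inputState M d C).nat 3 := by
        rw [f₂.nat 3 (by decide), f₁.nat 3 (by decide)]
      have hr : s₂.real 0 = (inputState M d C).real 0 := by
        rw [f₂.real 0 (by decide), f₁.real 0 (by decide)]
      refine Or.inr (Or.inr ⟨h5, s₂.nat 10 0 0, Nat.one_le_iff_ne_zero.2 h0, hmK.trans hKcard, e,
        ⟨hn₃, ?_, fun i j => ?_, fun i j r h => ?_⟩, fun h => h.submatrix e, fun h => ?_⟩)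
      · rw [hd₃, f₂.nat 1 (by decide), f₁.nat 1 (by decide), hd₀]
      · rw [(hmat i i.2 j j.2).1, ← hev, ← hev, h3, inputState_pattern]
        rfl
      · rw [(hmat i i.2 j j.2).2, ← hev, ← hev, hr, inputState_real]
        rw [Matrix.submatrix_apply] at h
        rw [h]
        rfl
      · obtain ⟨p, hp⟩ := IsYes.exists_realizes hM hC e.toEmbedding h
        refine hglue p fun i => ?_
        rw [← hrange]
        exact hp i
  · refine Or.inl ⟨h5₁, fun hyes => ?_⟩
    obtain ⟨i, _, j, _, hno⟩ := hinv.2 h6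
    -- The whole matrix is its own principal submatrix, so a yes-instance would realize every
    -- clique, and with it the rejected intersection.
    obtain ⟨p, hp⟩ := IsYes.exists_realizes hM hC (Function.Embedding.refl (Fin n)) hyes
    refine hno ⟨p, (hp i).mono fun v hv => ⟨⟨⟨v, hcn i v hv.1⟩, rfl⟩, hv.1⟩⟩

end EDMC

theorem theorem1p4 :
    ∃ (A : RealRAM.Prog) (P : Polynomial ℕ),
      ∀ (n k d : ℕ) (G : SimpleGraph (Fin n)) (M : EDMC.PartialMatrix n)
        (C : Fin k → Finset (Fin n)),
        EDMC.IsGPartial G M → EDMC.IsEdgeCliqueCover G C →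
        ∃ (t : ℕ) (s : RealRAM.State),
          RealRAM.Runs A (EDMC.inputState M d C) t s ∧
          t ≤ P.eval (n + k) ∧
          EDMC.IsCorrectOutput M d ((d + 1) * k ^ 2) s :=
  ⟨EDMC.kernelize, EDMC.kernelize.timePoly, fun _ _ _ _ _ _ hM hC => EDMC.does_kernelize hM hC⟩
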